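/- Let $K$ be a field. All algebras are associative $K$-algebras, possibly without unit, whose product is non-degenerate. For such an algebra $A$ let $M(A)$ be its multiplier algebra. A multiplier Hopf algebra is such an algebra $A$ with a coassociative homomorphism $\Delta:A\to M(A\otimes A)$ such that $\Delta(a)(1\otimes b)$ and $(a\otimes 1)\Delta(b)$ lie in $A\otimes A$ for all $a,b\in A$, and such that the maps $a\otimes b\mapsto\Delta(a)(1\otimes b)$ and $a\otimes b\mapsto(a\otimes1)\Delta(b)$ are bijections of $A\otimes A$. It is regular if $(A,\Delta^{\mathrm{cop}})$ is a multiplier Hopf algebra too; its antipode $S$ is then a bijection of $A$. Let $A$ and $B$ be regular multiplier Hopf algebras with a pairing $\langle\cdot,\cdot\rangle:A\times B\to K$. That is, $\langle\cdot,\cdot\rangle$ is a non-degenerate bilinear form such that the multipliers $$b\blacktriangleright a=\langle a_{(2)},b\rangle a_{(1)},\quad a\blacktriangleleft b=\langle a_{(1)},b\rangle a_{(2)},\quad a\blacktriangleright b=\langle a,b_{(2)}\rangle b_{(1)},\quad b\blacktriangleleft a=\langle a,b_{(1)}\rangle b_{(2)}$$ lie in $A$, $A$, $B$, $B$ respectively,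 and the products are dual to the coproducts: $$\langle aa',b\rangle=\langle a,a'\blacktriangleright b\rangle=\langle a',b\blacktriangleleft a\rangle,\qquad \langle a,bb'\rangle=\langle b'\blacktriangleright a,b\rangle=\langle a\blacktriangleleft b,b'\rangle .$$ Let $\mathscr D=A\bowtie B$ be the Drinfel'd double: the space $A\otimes B$ with product $$(a\bowtie b)(a'\bowtie b')=a\,\bigl(b_{(1)}\blacktriangleright a'\blacktriangleleft S^{-1}(b_{(3)})\bigr)\bowtie b_{(2)}b'.$$ Let $\mathscr H=A\# B$ be the Heisenberg double, whose underlying space is $A\otimes B$. Consider $$(a\bowtie b)\cdot(a'\# b')=a_{(3)}(b_{(1)}\blacktriangleright a')S^{-1}(a_{(2)})\ \#\ \bigl(b_{(2)}b'S(b_{(3)})\bigr)\blacktriangleleft S^{-1}(a_{(1)}). \qquad (*)$$ Then the bijective antipodes of $A$ and $B$ exist, and the expressions entering the product of $\mathscr D$ and $(*)$ are well-defined: the expressions $b_{(1)}\blacktriangleright a\otimes b_{(2)}$ and $a\blacktriangleleft S^{-1}(b_{(2)})\otimes b_{(1)}$ are elements of $A\otimes B$, and $b\blacktriangleleft S^{-1}(a_{(1)})\otimes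 a_{(2)}$ is an element of $B\otimes A$, all depending bilinearly on $a\in A$ and $b\in B$. Moreover, $(*)$ makes $\mathscr H$ a unital left $\mathscr D$-module: $(xy)\cdot h=x\cdot(y\cdot h)$ for all $x,y\in\mathscr D$ and $h\in\mathscr H$, and $\mathscr D\cdot\mathscr H=\mathscr H$, where $\mathscr D\cdot\mathscr H$ is the linear span of all $x\cdot h$. -/

import Mathlib

open TensorProduct

/-! Multiplier algebras, (regular) multiplier Hopf algebras, pairings, the product of the Drinfel'd
double and its action on the Heisenberg double, over a field `K`. All algebras are associative but
possibly without unit. -/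

/-- The product of the algebra `A` is non-degenerate as a bilinear map. -/
def NondegenerateMul (A : Type*) [NonUnitalRing A] : Prop :=
  (∀ x : A, (∀ y : A, x * y = 0) → x = 0) ∧ (∀ y : A, (∀ x : A, x * y = 0) → y = 0)

section Multiplier

variable (K : Type*) [Field K]
  (A : Type*) [NonUnitalRing A] [Module K A] [IsScalarTower K A A] [SMulCommClass K A A]
  (B : Type*) [NonUnitalRing B] [Module K B] [IsScalarTower K B B] [SMulCommClass K B B]

/-- The multiplier algebra `M(A)`: pairs `m = (L, R)` of linear maps, thought of as `L x = m x` and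
`R x = x m`, with `m (x y) = (m x) y`, `(x y) m = x (y m)` and `(x m) y = x (m y)`.
The product is `(L, R) (L', R') = (L ∘ L', R' ∘ R)`. -/
def Multiplier : Subalgebra K (Module.End K A × (Module.End K A)ᵐᵒᵖ) where
  carrier := {m | (∀ x y : A, m.1 (x * y) = m.1 x * y) ∧
    (∀ x y : A, m.2.unop (x * y) = x * m.2.unop y) ∧
    (∀ x y : A, m.2.unop x * y = x * m.1 y)}
  mul_mem' := by
    rintro m n ⟨h1, h2, h3⟩ ⟨k1, k2, k3⟩
    refine ⟨fun x y => ?_, fun x y => ?_, fun x y => ?_⟩ <;>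
      simp [h1, h2, h3, k1, k2, k3]
  add_mem' := by
    rintro m n ⟨h1, h2, h3⟩ ⟨k1, k2, k3⟩
    refine ⟨fun x y => ?_, fun x y => ?_, fun x y => ?_⟩ <;>
      simp [h1, h2, h3, k1, k2, k3, mul_add, add_mul]
  algebraMap_mem' := by
    intro r
    refine ⟨fun x y => ?_, fun x y => ?_, fun x y => ?_⟩ <;>
      simp [Module.algebraMap_end_apply, smul_mul_assoc, mul_smul_comm]

namespace Multiplier

variable {K A B}

/-- Left multiplication `x ↦ m x` by a multiplier. -/
def left (m : Multiplier K A) : A →ₗ[K] A := m.1.1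

/-- Right multiplication `x ↦ x m` by a multiplier. -/
def right (m : Multiplier K A) : A →ₗ[K] A := m.1.2.unop

/-- The canonical map `A → M(A)`, injective when the product of `A` is non-degenerate. -/
def ofElem (a : A) : Multiplier K A :=
  ⟨(LinearMap.mulLeft K a, MulOpposite.op (LinearMap.mulRight K a)),
    fun x y => by simp [mul_assoc], fun x y => by simp [mul_assoc],
    fun x y => by simp [mul_assoc]⟩

/-- The multiplier `m ⊗ n` of `A ⊗ B`. -/
def tmul (m : Multiplier K A) (n : Multiplier K B) : Multiplier K (A ⊗[K] B) :=
  ⟨(TensorProduct.map (left m) (left n), MulOpposite.op (TensorProduct.map (right m) (right n))), by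
    obtain ⟨m, h1, h2, h3⟩ := m
    obtain ⟨n, k1, k2, k3⟩ := n
    refine ⟨fun x y => ?_, fun x y => ?_, fun x y => ?_⟩ <;>
    · induction x using TensorProduct.induction_on with
      | zero => simp
      | add x x' hx hx' => simp only [add_mul, map_add, hx, hx']
      | tmul a b =>
        induction y using TensorProduct.induction_on with
        | zero => simp
        | add y y' hy hy' => simp only [mul_add, map_add, hy, hy']
        | tmul c d =>
          simp only [left, right] at *
          simp [h1, h2, h3, k1, k2, k3]⟩

/-- The extension to `M(A ⊗ A)` of the flip map of `A ⊗ A`. -/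
def flip (m : Multiplier K (A ⊗[K] A)) : Multiplier K (A ⊗[K] A) :=
  ⟨((TensorProduct.comm K A A).toLinearMap ∘ₗ left m ∘ₗ (TensorProduct.comm K A A).toLinearMap,
    MulOpposite.op ((TensorProduct.comm K A A).toLinearMap ∘ₗ right m ∘ₗ
      (TensorProduct.comm K A A).toLinearMap)), by
    have hc : ∀ x y : A ⊗[K] A, TensorProduct.comm K A A (x * y) =
        TensorProduct.comm K A A x * TensorProduct.comm K A A y := by
      intro x y
      induction x using TensorProduct.induction_on with
      | zero => simp
      | add x x' hx hx' => simp only [add_mul, map_add, hx, hx']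
      | tmul a b =>
        induction y using TensorProduct.induction_on with
        | zero => simp
        | add y y' hy hy' => simp only [mul_add, map_add, hy, hy']
        | tmul c d => simp
    have hcc : ∀ x : A ⊗[K] A, TensorProduct.comm K A A (TensorProduct.comm K A A x) = x :=
      fun x => (TensorProduct.comm K A A).symm_apply_apply x
    obtain ⟨m, h1, h2, h3⟩ := m
    refine ⟨fun x y => ?_, fun x y => ?_, fun x y => ?_⟩
    · simp [left, hc, h1, hcc]
    · simp [right, hc, h2, hcc]
    · have := congrArg (TensorProduct.comm K A A)
        (h3 (TensorProduct.comm K A A x) (TensorProduct.comm K A A y))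
      simpa [left, right, hc, hcc] using this⟩

end Multiplier

end Multiplier

/-- A multiplier Hopf algebra structure on the algebra `A`: a homomorphism `Δ : A → M(A ⊗ A)` such
that `Δ(a)(1 ⊗ b)` and `(a ⊗ 1)Δ(b)` lie in `A ⊗ A`, the linear maps
`T₁ (a ⊗ b) = Δ(a)(1 ⊗ b)` and `T₂ (a ⊗ b) = (a ⊗ 1)Δ(b)` are bijective, and `Δ` is coassociative,
`(a ⊗ 1 ⊗ 1)(Δ ⊗ ι)(Δ(b)(1 ⊗ c)) = (ι ⊗ Δ)((a ⊗ 1)Δ(b))(1 ⊗ 1 ⊗ c)`.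
The maps `T₁`, `T₂` are determined by `Δ`. -/
structure MultiplierHopfAlgebra (K : Type*) [Field K] (A : Type*) [NonUnitalRing A] [Module K A]
    [IsScalarTower K A A] [SMulCommClass K A A] where
  nondegenerate : NondegenerateMul A
  comul : A →ₙₐ[K] Multiplier K (A ⊗[K] A)
  T₁ : A ⊗[K] A ≃ₗ[K] A ⊗[K] A
  T₂ : A ⊗[K] A ≃ₗ[K] A ⊗[K] A
  T₁_spec : ∀ a b : A, Multiplier.ofElem (T₁ (a ⊗ₜ b)) =
    comul a * Multiplier.tmul 1 (Multiplier.ofElem b)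
  T₂_spec : ∀ a b : A, Multiplier.ofElem (T₂ (a ⊗ₜ b)) =
    Multiplier.tmul (Multiplier.ofElem a) 1 * comul b
  coassoc : ∀ a b c : A,
    TensorProduct.assoc K A A A
        (T₂.toLinearMap.rTensor A ((TensorProduct.assoc K A A A).symm (a ⊗ₜ T₁ (b ⊗ₜ c)))) =
      T₁.toLinearMap.lTensor A (TensorProduct.assoc K A A A (T₂ (a ⊗ₜ b) ⊗ₜ c))

/-- A regular multiplier Hopf algebra: `(A, Δ)` and `(A, Δᶜᵒᵖ)` are multiplier Hopf algebras.
Here `cop` is the structure `(A, Δᶜᵒᵖ)`, so that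
`cop.T₁ (a ⊗ b) = Δᶜᵒᵖ(a)(1 ⊗ b) = a₍₂₎ ⊗ a₍₁₎ b`; it is determined by `Δ`. -/
structure RegularMultiplierHopfAlgebra (K : Type*) [Field K] (A : Type*) [NonUnitalRing A]
    [Module K A] [IsScalarTower K A A] [SMulCommClass K A A]
    extends MultiplierHopfAlgebra K A where
  cop : MultiplierHopfAlgebra K A
  cop_comul : ∀ a : A, cop.comul a = Multiplier.flip (comul a)

namespace MultiplierHopfAlgebra

variable {K : Type*} [Field K] {A : Type*} [NonUnitalRing A] [Module K A]
  [IsScalarTower K A A] [SMulCommClass K A A] (H : MultiplierHopfAlgebra K A)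

/-- The counit: `ε(a₍₁₎) a₍₂₎ b = a b` and `a b₍₁₎ ε(b₍₂₎) = a b`. -/
def IsCounit (ε : A →ₗ[K] K) : Prop :=
  (∀ a b : A, TensorProduct.lid K A (ε.rTensor A (H.T₁ (a ⊗ₜ b))) = a * b) ∧
  (∀ a b : A, TensorProduct.rid K A (ε.lTensor A (H.T₂ (a ⊗ₜ b))) = a * b)

/-- The antipode, as a bijection of `A`: `S(a₍₁₎) a₍₂₎ b = ε(a) b` and
`a b₍₁₎ S(b₍₂₎) = ε(b) a`. -/
def IsAntipode (S : A ≃ₗ[K] A) : Prop :=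
  ∃ ε : A →ₗ[K] K, H.IsCounit ε ∧
    (∀ a b : A, LinearMap.mul' K A (S.toLinearMap.rTensor A (H.T₁ (a ⊗ₜ b))) = ε a • b) ∧
    (∀ a b : A, LinearMap.mul' K A (S.toLinearMap.lTensor A (H.T₂ (a ⊗ₜ b))) = ε b • a)

/-- The antipode `S : A → A`; by the identities of `IsAntipode` it is unique if it exists. (A
multiplier Hopf algebra has an antipode that is a bijection of `A` exactly when it is regular.) -/
noncomputable def antipode : A ≃ₗ[K] A := Classical.epsilon H.IsAntipode

/-- For a linear form `ω` and `a : A`, the left multiplication `x ↦ ω(a₍₁₎) a₍₂₎ x` by the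
multiplier `ω(a₍₁₎) a₍₂₎`. -/
noncomputable def slice (ω : A →ₗ[K] K) (a : A) : A →ₗ[K] A :=
  (TensorProduct.lid K A).toLinearMap ∘ₗ ω.rTensor A ∘ₗ H.T₁.toLinearMap ∘ₗ
    TensorProduct.mk K A A a

theorem eq_of_mul_eq (H : MultiplierHopfAlgebra K A) {x y : A} (h : ∀ z : A, x * z = y * z) : x = y := by
  refine sub_eq_zero.mp (H.nondegenerate.1 _ fun z => ?_)
  rw [sub_mul, h, sub_self]

variable {E : Type*} [AddCommGroup E] [Module K E] (β : E →ₗ[K] A →ₗ[K] K)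

/-- If all multipliers `β(e, a₍₁₎) a₍₂₎` lie in `A`, the bilinear map sending `(e, a)` to that
element of `A`. -/
noncomputable def sliceElem (h : ∀ e a, ∃ c : A, ∀ x, c * x = H.slice (β e) a x) :
    E →ₗ[K] A →ₗ[K] A :=
  LinearMap.mk₂ K (fun e a => (h e a).choose)
    (fun e e' a => H.eq_of_mul_eq fun z => by
      rw [add_mul, (h _ _).choose_spec, (h _ _).choose_spec, (h _ _).choose_spec]
      simp [slice, LinearMap.rTensor_add])
    (fun r e a => H.eq_of_mul_eq fun z => by
      rw [smul_mul_assoc, (h _ _).choose_spec, (h _ _).choose_spec]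
      simp [slice, LinearMap.rTensor_smul])
    (fun e a a' => H.eq_of_mul_eq fun z => by
      rw [add_mul, (h _ _).choose_spec, (h _ _).choose_spec, (h _ _).choose_spec]
      simp [slice])
    (fun r e a => H.eq_of_mul_eq fun z => by
      rw [smul_mul_assoc, (h _ _).choose_spec, (h _ _).choose_spec]
      simp [slice])

theorem sliceElem_mul (h : ∀ e a, ∃ c : A, ∀ x, c * x = H.slice (β e) a x) (e : E) (a x : A) :
    H.sliceElem β h e a * x = H.slice (β e) a x :=
  (h e a).choose_spec x

section Leg

variable {V W : Type*} [AddCommGroup V] [Module K V] [AddCommGroup W] [Module K W]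
  (f : A →ₗ[K] V →ₗ[K] W)

/-- `Θ a v = f(a₍₁₎, v) ⊗ a₍₂₎` in `W ⊗ A`, that is
`Θ a v (1 ⊗ x) = f(a₍₁₎, v) ⊗ a₍₂₎ x` for all `x`, where `a₍₁₎ ⊗ a₍₂₎ x = T₁ (a ⊗ x)` lies in
`A ⊗ A`. Since the product of `A` is non-degenerate, `Θ` is unique if it exists. -/
def IsLeg (Θ : A →ₗ[K] V →ₗ[K] W ⊗[K] A) : Prop :=
  ∀ (a : A) (v : V) (x : A),
    (LinearMap.mulRight K x).lTensor W (Θ a v) = (f.flip v).rTensor A (H.T₁ (a ⊗ₜ x))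

/-- The bilinear map `(a, v) ↦ f(a₍₁₎, v) ⊗ a₍₂₎`. -/
noncomputable def leg : A →ₗ[K] V →ₗ[K] W ⊗[K] A := Classical.epsilon (H.IsLeg f)

end Leg

end MultiplierHopfAlgebra

namespace RegularMultiplierHopfAlgebra

variable {K : Type*} [Field K] {A : Type*} [NonUnitalRing A] [Module K A]
  [IsScalarTower K A A] [SMulCommClass K A A] (H : RegularMultiplierHopfAlgebra K A)

/-- The adjoint action `a ⊗ a' ↦ a₍₁₎ a' S(a₍₂₎)`, computed from
`cop.T₁ (a ⊗ a') = a₍₂₎ ⊗ a₍₁₎ a'`. -/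
noncomputable def adjoint : A ⊗[K] A →ₗ[K] A :=
  LinearMap.mul' K A ∘ₗ (TensorProduct.comm K A A).toLinearMap ∘ₗ
    H.antipode.toLinearMap.rTensor A ∘ₗ H.cop.T₁.toLinearMap

/-- The adjoint action `a ⊗ a' ↦ a₍₂₎ a' S⁻¹(a₍₁₎)`, computed from `T₁ (a ⊗ a') = a₍₁₎ ⊗ a₍₂₎ a'`. -/
noncomputable def adjointInv : A ⊗[K] A →ₗ[K] A :=
  LinearMap.mul' K A ∘ₗ (TensorProduct.comm K A A).toLinearMap ∘ₗ
    H.antipode.symm.toLinearMap.rTensor A ∘ₗ H.T₁.toLinearMap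

end RegularMultiplierHopfAlgebra

section Pairing

variable {K : Type*} [Field K]
  {A : Type*} [NonUnitalRing A] [Module K A] [IsScalarTower K A A] [SMulCommClass K A A]
  {B : Type*} [NonUnitalRing B] [Module K B] [IsScalarTower K B B] [SMulCommClass K B B]

/-- A non-degenerate bilinear form on `A × B` satisfying the regularity conditions: the multipliers
`b ▶ a = ⟨a₍₂₎, b⟩ a₍₁₎` and `a ◀ b = ⟨a₍₁₎, b⟩ a₍₂₎` lie in `A`, and
`a ▶ b = ⟨a, b₍₂₎⟩ b₍₁₎` and `b ◀ a = ⟨a, b₍₁₎⟩ b₍₂₎` lie in `B`. -/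
structure RegularForm (HA : RegularMultiplierHopfAlgebra K A)
    (HB : RegularMultiplierHopfAlgebra K B) where
  form : A →ₗ[K] B →ₗ[K] K
  nondegenerate : form.Nondegenerate
  regular_lA : ∀ b a, ∃ c : A, ∀ x, c * x = HA.cop.slice (form.flip b) a x
  regular_rA : ∀ b a, ∃ c : A, ∀ x, c * x = HA.slice (form.flip b) a x
  regular_lB : ∀ a b, ∃ c : B, ∀ x, c * x = HB.cop.slice (form a) b x
  regular_rB : ∀ a b, ∃ c : B, ∀ x, c * x = HB.slice (form a) b x

namespace RegularForm

variable {HA : RegularMultiplierHopfAlgebra K A} {HB : RegularMultiplierHopfAlgebra K B}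
  (P : RegularForm HA HB)

/-- `lA b a = b ▶ a = ⟨a₍₂₎, b⟩ a₍₁₎`. -/
noncomputable def lA : B →ₗ[K] A →ₗ[K] A := HA.cop.sliceElem P.form.flip P.regular_lA

/-- `rA b a = a ◀ b = ⟨a₍₁₎, b⟩ a₍₂₎`. -/
noncomputable def rA : B →ₗ[K] A →ₗ[K] A := HA.sliceElem P.form.flip P.regular_rA

/-- `lB a b = a ▶ b = ⟨a, b₍₂₎⟩ b₍₁₎`. -/
noncomputable def lB : A →ₗ[K] B →ₗ[K] B := HB.cop.sliceElem P.form P.regular_lB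

/-- `rB a b = b ◀ a = ⟨a, b₍₁₎⟩ b₍₂₎`. -/
noncomputable def rB : A →ₗ[K] B →ₗ[K] B := HB.sliceElem P.form P.regular_rB

end RegularForm

/-- A pairing of regular multiplier Hopf algebras: a non-degenerate form with the regularity
conditions such that the product of each algebra is dual to the coproduct of the other, i.e.
`⟨a a', b⟩ = ⟨a, b₍₁₎⟩ ⟨a', b₍₂₎⟩` and `⟨a, b b'⟩ = ⟨a₍₁₎, b⟩ ⟨a₍₂₎, b'⟩`, the right-hand sides
being evaluated one leg at a time, in either order. -/
structure HopfPairing (HA : RegularMultiplierHopfAlgebra K A)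
    (HB : RegularMultiplierHopfAlgebra K B) extends RegularForm HA HB where
  form_mul_left : ∀ a a' b, form (a * a') b = form a (toRegularForm.lB a' b)
  form_mul_left' : ∀ a a' b, form (a * a') b = form a' (toRegularForm.rB a b)
  form_mul_right : ∀ a b b', form a (b * b') = form (toRegularForm.lA b' a) b
  form_mul_right' : ∀ a b b', form a (b * b') = form (toRegularForm.rA b a) b'

namespace HopfPairing

variable {HA : RegularMultiplierHopfAlgebra K A} {HB : RegularMultiplierHopfAlgebra K B}
  (P : HopfPairing HA HB)

/-- `(b, a) ↦ a ◀ S⁻¹(b)`. -/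
noncomputable def rAInv : B →ₗ[K] A →ₗ[K] A := P.rA ∘ₗ HB.antipode.symm.toLinearMap

/-- `(a, b) ↦ b ◀ S⁻¹(a)`. -/
noncomputable def rBInv : A →ₗ[K] B →ₗ[K] B := P.rB ∘ₗ HA.antipode.symm.toLinearMap

/-- `G (b ⊗ a) = b₍₁₎ ▶ a ⊗ b₍₂₎`. -/
noncomputable def G : B ⊗[K] A →ₗ[K] A ⊗[K] B := TensorProduct.lift (HB.leg P.lA)

/-- `G' (b ⊗ a) = a ◀ S⁻¹(b₍₂₎) ⊗ b₍₁₎`. -/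
noncomputable def G' : B ⊗[K] A →ₗ[K] A ⊗[K] B := TensorProduct.lift (HB.cop.leg P.rAInv)

/-- `F (a ⊗ b) = b ◀ S⁻¹(a₍₁₎) ⊗ a₍₂₎`. -/
noncomputable def F : A ⊗[K] B →ₗ[K] B ⊗[K] A := TensorProduct.lift (HA.leg P.rBInv)

/-- The twist map `T (b ⊗ a) = b₍₁₎ ▶ a ◀ S⁻¹(b₍₃₎) ⊗ b₍₂₎` of the Drinfel'd double:
`b ⊗ a ↦ b₍₁₎ ▶ a ⊗ b₍₂₎ ↦ b₍₂₎ ⊗ b₍₁₎ ▶ a ↦ (b₍₁₎ ▶ a) ◀ S⁻¹(b₍₃₎) ⊗ b₍₂₎`. -/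
noncomputable def twist : B ⊗[K] A →ₗ[K] A ⊗[K] B :=
  P.G' ∘ₗ (TensorProduct.comm K A B).toLinearMap ∘ₗ P.G

/-- The product `(a ⋈ b)(a' ⋈ b') = (m ⊗ m)(ι ⊗ T ⊗ ι)(a ⊗ b ⊗ a' ⊗ b')` of the Drinfel'd double
`𝒟 = A ⋈ B`, with underlying space `A ⊗ B`. -/
noncomputable def doubleMul : A ⊗[K] B →ₗ[K] A ⊗[K] B →ₗ[K] A ⊗[K] B :=
  TensorProduct.curry
    (TensorProduct.map (LinearMap.mul' K A) (LinearMap.mul' K B) ∘ₗ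
      (TensorProduct.tensorTensorTensorAssoc K A A B B).symm.toLinearMap ∘ₗ
      (P.twist.lTensor A).rTensor B ∘ₗ
      (TensorProduct.tensorTensorTensorAssoc K A B A B).toLinearMap)

/-- `(x ⊗ a) ⊗ b ↦ a₍₃₎ x S⁻¹(a₍₂₎) ⊗ b ◀ S⁻¹(a₍₁₎)`:
`(x ⊗ a) ⊗ b ↦ x ⊗ (b ◀ S⁻¹(a₍₁₎) ⊗ a₍₂₎) ↦ b ◀ S⁻¹(a₍₁₎) ⊗ (a₍₂₎ ⊗ x)
  ↦ b ◀ S⁻¹(a₍₁₎) ⊗ a₍₃₎ x S⁻¹(a₍₂₎)`, followed by the flip. -/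
noncomputable def actA : (A ⊗[K] A) ⊗[K] B →ₗ[K] A ⊗[K] B :=
  (TensorProduct.comm K B A).toLinearMap ∘ₗ
    HA.adjointInv.lTensor B ∘ₗ
    (TensorProduct.assoc K B A A).toLinearMap ∘ₗ
    (TensorProduct.comm K A (B ⊗[K] A)).toLinearMap ∘ₗ
    P.F.lTensor A ∘ₗ
    (TensorProduct.assoc K A A B).toLinearMap

/-- The action of `𝒟 = A ⋈ B` on (the space `A ⊗ B` of) the Heisenberg double `ℋ = A # B`,
`(a ⋈ b) · (a' # b') =
  a₍₃₎ (b₍₁₎ ▶ a') S⁻¹(a₍₂₎) # (b₍₂₎ b' S(b₍₃₎)) ◀ S⁻¹(a₍₁₎)`: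
`a ⊗ b ⊗ a' ⊗ b' ↦ a ⊗ (b₍₁₎ ▶ a') ⊗ b₍₂₎ ⊗ b' ↦ a ⊗ (b₍₁₎ ▶ a') ⊗ b₍₂₎ b' S(b₍₃₎)`,
followed by `actA`. -/
noncomputable def action : A ⊗[K] B →ₗ[K] A ⊗[K] B →ₗ[K] A ⊗[K] B :=
  TensorProduct.curry
    (P.actA ∘ₗ
      (TensorProduct.comm K A A).toLinearMap.rTensor B ∘ₗ
      HB.adjoint.lTensor (A ⊗[K] A) ∘ₗ
      (TensorProduct.tensorTensorTensorAssoc K A A B B).symm.toLinearMap ∘ₗ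
      (P.G.lTensor A).rTensor B ∘ₗ
      (TensorProduct.tensorTensorTensorAssoc K A B A B).toLinearMap)

/-- All Sweedler expressions that enter the product of `𝒟` and the action on `ℋ` are well-defined:
the antipodes of `A` and `B` exist, and `b₍₁₎ ▶ a ⊗ b₍₂₎`, `a ◀ S⁻¹(b₍₂₎) ⊗ b₍₁₎` in `A ⊗ B` and
`b ◀ S⁻¹(a₍₁₎) ⊗ a₍₂₎` in `B ⊗ A` exist. -/
structure WellDefined : Prop where
  antipode_A : HA.IsAntipode HA.antipode
  antipode_B : HB.IsAntipode HB.antipode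
  leg_G : HB.IsLeg P.lA (HB.leg P.lA)
  leg_G' : HB.cop.IsLeg P.rAInv (HB.cop.leg P.rAInv)
  leg_F : HA.IsLeg P.rBInv (HA.leg P.rBInv)

end HopfPairing

end Pairing

/-!
Sweedler notation is made rigorous by slicing. Since the form `⟨·, ·⟩` is non-degenerate, a tensor
in `W ⊗ A` is determined by its slices `ι ⊗ ⟨·, b⟩`, and the slices of the tensors that occur here
are given by the four actions: for instance `T₁ (a ⊗ c) = a₍₁₎ ⊗ a₍₂₎ c` has the slices
`(c ▶ b) ▶ a` and `(a ◀ b) c`, and `b₍₁₎ ▶ a ⊗ b₍₂₎` has the slices `(α ▶ b) ▶ a`. Coassociativity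
thus turns into the bimodule laws of the actions. As `T₁` is bijective, its slices show that
`B ▶ A = A` (`DualActions.span_r`), and this makes the Sweedler expressions well-defined: for
`a = c ▶ a'`, the tensor `b₍₁₎ ▶ a ⊗ b₍₂₎ = b₍₁₎ c ▶ a' ⊗ b₍₂₎` is covered by `c`
(`DualActions.isLeg_leg_of_cover`). Counit and antipode are constructed before, as by Van Daele. In
the regular case the antipode is a bijection of `A` because `S(S⁻¹(b) a) = S(a) b`, where both
sides can be defined by means of the counit (`exists_isAntipode`).

For the module property, the Heisenberg double acts faithfully on `A` by
`(a # b) x = a (b ▶ x)` (`rep`, `rep_injective`), and `(*)` is the adjoint action: in `End A`,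
`a h = (a₍₂₎ · h) a₍₁₎` and `b h = (b₍₁₎ · h) b₍₂₎` for `a ∈ A`, `b ∈ B` and `h ∈ A # B`
(`rep_actionA_T₁`, `rep_actionB_T₁`). Here `(a ⋈ b) · h = a · (b · h)` (`action_tmul`). The two
relations determine the actions of `A` and of `B`, and imply that both are multiplicative
(`map_mul_of_adjoint`). Moving `b ∈ B` and `a ∈ A` past `h` in either order and comparing gives
`b₍₁₎ · ((a ◀ b₍₂₎) · h) = (b₍₁₎ ▶ a) · (b₍₂₎ · h)` (`actionB_actionA_G₁`). This is the commutation
relation of the Drinfel'd double, because the twist map takes `b₍₁₎ ⊗ (a ◀ b₍₂₎)` to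
`b₍₁₎ ▶ a ⊗ b₍₂₎` (`twist_comm_G₁`). Finally `𝒟 · ℋ = ℋ`, because the actions of `A` and `B` are
compositions of surjective maps.
-/

/-! ### Slices of tensors and separation of points -/

namespace TensorProduct

variable {K : Type*} [Field K] {V W U : Type*} [AddCommGroup V] [Module K V]
  [AddCommGroup W] [Module K W] [AddCommGroup U] [Module K U]

/-- The slice map `ι ⊗ φ : W ⊗ V → W` of a linear form `φ` on `V`. -/
noncomputable def sliceRight (φ : V →ₗ[K] K) : W ⊗[K] V →ₗ[K] W :=
  (TensorProduct.rid K W).toLinearMap ∘ₗ φ.lTensor W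

/-- The slice map `φ ⊗ ι : V ⊗ W → W` of a linear form `φ` on `V`. -/
noncomputable def sliceLeft (φ : V →ₗ[K] K) : V ⊗[K] W →ₗ[K] W :=
  (TensorProduct.lid K W).toLinearMap ∘ₗ φ.rTensor W

@[simp] theorem sliceRight_tmul (φ : V →ₗ[K] K) (w : W) (v : V) :
    sliceRight φ (w ⊗ₜ[K] v) = φ v • w := by simp [sliceRight]

@[simp] theorem sliceLeft_tmul (φ : V →ₗ[K] K) (v : V) (w : W) :
    sliceLeft φ (v ⊗ₜ[K] w) = φ v • w := by simp [sliceLeft]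

theorem sliceRight_add (φ ψ : V →ₗ[K] K) :
    sliceRight (W := W) (φ + ψ) = sliceRight φ + sliceRight ψ :=
  TensorProduct.ext' fun w v => by simp [add_smul]

theorem sliceRight_smul (c : K) (φ : V →ₗ[K] K) :
    sliceRight (W := W) (c • φ) = c • sliceRight φ :=
  TensorProduct.ext' fun w v => by simp [mul_smul]

theorem sliceLeft_add (φ ψ : V →ₗ[K] K) :
    sliceLeft (W := W) (φ + ψ) = sliceLeft φ + sliceLeft ψ :=
  TensorProduct.ext' fun v w => by simp [add_smul]

theorem sliceLeft_smul (c : K) (φ : V →ₗ[K] K) :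
    sliceLeft (W := W) (c • φ) = c • sliceLeft φ :=
  TensorProduct.ext' fun v w => by simp [mul_smul]

theorem sliceLeft_comm (φ : V →ₗ[K] K) (t : W ⊗[K] V) :
    sliceLeft φ (TensorProduct.comm K W V t) = sliceRight φ t := by
  induction t with
  | zero => simp
  | tmul x y => simp
  | add x y hx hy => simp only [map_add, hx, hy]

theorem sliceRight_comm (φ : V →ₗ[K] K) (t : V ⊗[K] W) :
    sliceRight φ (TensorProduct.comm K V W t) = sliceLeft φ t := by
  induction t with
  | zero => simp
  | tmul x y => simp
  | add x y hx hy => simp only [map_add, hx, hy]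

theorem sliceRight_rTensor (φ : V →ₗ[K] K) (f : W →ₗ[K] U) (t : W ⊗[K] V) :
    sliceRight φ (f.rTensor V t) = f (sliceRight φ t) := by
  induction t with
  | zero => simp
  | tmul x y => simp
  | add x y hx hy => simp only [map_add, hx, hy]

theorem sliceRight_lTensor (φ : V →ₗ[K] K) (f : U →ₗ[K] V) (t : W ⊗[K] U) :
    sliceRight φ (f.lTensor W t) = sliceRight (φ ∘ₗ f) t := by
  induction t with
  | zero => simp
  | tmul x y => simp
  | add x y hx hy => simp only [map_add, hx, hy]

theorem sliceLeft_lTensor (φ : V →ₗ[K] K) (f : W →ₗ[K] U) (t : V ⊗[K] W) :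
    sliceLeft φ (f.lTensor V t) = f (sliceLeft φ t) := by
  induction t with
  | zero => simp
  | tmul x y => simp
  | add x y hx hy => simp only [map_add, hx, hy]

theorem sliceLeft_rTensor (φ : V →ₗ[K] K) (f : U →ₗ[K] V) (t : U ⊗[K] W) :
    sliceLeft φ (f.rTensor W t) = sliceLeft (φ ∘ₗ f) t := by
  induction t with
  | zero => simp
  | tmul x y => simp
  | add x y hx hy => simp only [map_add, hx, hy]

/-- The two ways of applying a pair of linear forms to a tensor agree. -/
theorem apply_sliceLeft (φ : V →ₗ[K] K) (ψ : W →ₗ[K] K) (t : V ⊗[K] W) :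
    ψ (sliceLeft φ t) = φ (sliceRight ψ t) := by
  induction t with
  | zero => simp
  | tmul x y => simp [mul_comm]
  | add x y hx hy => simp only [map_add, hx, hy]

/-- A jointly injective family of linear maps stays jointly injective after tensoring with a vector
space. -/
theorem eq_zero_of_lTensor {ι : Sort*} {C : Type*} [AddCommGroup C] [Module K C]
    (f : ι → V →ₗ[K] C) (hf : ∀ v, (∀ i, f i v = 0) → v = 0)
    (w : W ⊗[K] V) (hw : ∀ i, (f i).lTensor W w = 0) : w = 0 := by
  have key : ∀ (φ : W →ₗ[K] K) (i : ι) (t : W ⊗[K] V),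
      f i (sliceLeft φ t) = sliceLeft φ ((f i).lTensor W t) :=
    fun φ i t => (sliceLeft_lTensor φ (f i) t).symm
  let b := Module.Free.chooseBasis K W
  apply (TensorProduct.equivFinsuppOfBasisLeft (N := V) b).injective
  rw [map_zero]
  ext i
  rw [TensorProduct.equivFinsuppOfBasisLeft_apply, Finsupp.zero_apply]
  refine hf _ fun j => ?_
  have := key (b.coord i) j w
  rw [hw j, map_zero] at this
  exact this

theorem ext_sliceRight {ι : Sort*} (φ : ι → V →ₗ[K] K) (hφ : ∀ v, (∀ i, φ i v = 0) → v = 0)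
    {t t' : W ⊗[K] V} (h : ∀ i, sliceRight (φ i) t = sliceRight (φ i) t') : t = t' := by
  rw [← sub_eq_zero]
  refine eq_zero_of_lTensor φ hφ _ fun i => (TensorProduct.rid K W).injective ?_
  have := h i
  rw [← sub_eq_zero, ← map_sub] at this
  simpa [sliceRight] using this

theorem ext_sliceLeft {ι : Sort*} (φ : ι → V →ₗ[K] K) (hφ : ∀ v, (∀ i, φ i v = 0) → v = 0)
    {t t' : V ⊗[K] W} (h : ∀ i, sliceLeft (φ i) t = sliceLeft (φ i) t') : t = t' := by
  apply (TensorProduct.comm K V W).injective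
  refine ext_sliceRight φ hφ fun i => ?_
  rw [sliceRight_comm, sliceRight_comm, h i]

end TensorProduct

/-! ### The canonical maps of a multiplier Hopf algebra -/

section Nondegenerate

variable {K : Type*} [Field K] {A : Type*} [NonUnitalRing A] [Module K A]
  [IsScalarTower K A A]

theorem NondegenerateMul.eq_of_lTensor (hA : NondegenerateMul A) {W : Type*} [AddCommGroup W]
    [Module K W] {t t' : W ⊗[K] A}
    (h : ∀ x, (LinearMap.mulRight K x).lTensor W t = (LinearMap.mulRight K x).lTensor W t') :
    t = t' := by
  rw [← sub_eq_zero]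
  refine TensorProduct.eq_zero_of_lTensor (fun x : A => LinearMap.mulRight K x)
    (fun v hv => hA.1 v hv) _ fun i => ?_
  rw [map_sub, h i, sub_self]

theorem NondegenerateMul.eq_of_rTensor (hA : NondegenerateMul A) {W : Type*} [AddCommGroup W]
    [Module K W] {t t' : A ⊗[K] W}
    (h : ∀ x, (LinearMap.mulRight K x).rTensor W t = (LinearMap.mulRight K x).rTensor W t') :
    t = t' := by
  apply (TensorProduct.comm K A W).injective
  refine hA.eq_of_lTensor fun x => ?_
  rw [← LinearMap.comm_comp_rTensor_comp_comm_eq]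
  simp [h x]

variable [SMulCommClass K A A]

theorem TensorProduct.mul_tmul_eq (t : A ⊗[K] A) (x y : A) :
    t * (x ⊗ₜ[K] y) =
      (LinearMap.mulRight K y).lTensor A ((LinearMap.mulRight K x).rTensor A t) := by
  induction t with
  | zero => simp
  | tmul a b => simp
  | add a b ha hb => simp only [map_add, add_mul, ha, hb]

theorem NondegenerateMul.eq_of_mul_tmul (hA : NondegenerateMul A) {t t' : A ⊗[K] A}
    (h : ∀ x y, t * (x ⊗ₜ[K] y) = t' * (x ⊗ₜ[K] y)) : t = t' := by
  refine hA.eq_of_rTensor fun x => hA.eq_of_lTensor fun y => ?_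
  rw [← TensorProduct.mul_tmul_eq, ← TensorProduct.mul_tmul_eq, h]

end Nondegenerate

namespace MultiplierHopfAlgebra

variable {K : Type*} [Field K] {A : Type*} [NonUnitalRing A] [Module K A]
  [IsScalarTower K A A] [SMulCommClass K A A] (H : MultiplierHopfAlgebra K A)

/-- Left multiplication by the multiplier `Δ(a)` on `A ⊗ A`. -/
noncomputable def comulLeft (a : A) : A ⊗[K] A →ₗ[K] A ⊗[K] A := Multiplier.left (H.comul a)

theorem comulLeft_mul (a : A) (s t : A ⊗[K] A) :
    H.comulLeft a (s * t) = H.comulLeft a s * t := (H.comul a).2.1 s t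

theorem comulLeft_comp (a b : A) (t : A ⊗[K] A) :
    H.comulLeft (a * b) t = H.comulLeft a (H.comulLeft b t) := by
  simp [comulLeft, Multiplier.left]

theorem T₁_mul_tmul (a b : A) (t : A ⊗[K] A) :
    H.T₁ (a ⊗ₜ b) * t = H.comulLeft a ((LinearMap.mulLeft K b).lTensor A t) :=
  congrArg (fun m : Multiplier K (A ⊗[K] A) => Multiplier.left m t) (H.T₁_spec a b)

theorem T₂_mul_tmul (a b : A) (t : A ⊗[K] A) :
    H.T₂ (a ⊗ₜ b) * t = (LinearMap.mulLeft K a).rTensor A (H.comulLeft b t) :=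
  congrArg (fun m : Multiplier K (A ⊗[K] A) => Multiplier.left m t) (H.T₂_spec a b)

/-- `Δ(a)(x ⊗ b) = (Δ(a)(1 ⊗ b))(x ⊗ 1)`. -/
theorem comulLeft_tmul (a x b : A) :
    H.comulLeft a (x ⊗ₜ b) = (LinearMap.mulRight K x).rTensor A (H.T₁ (a ⊗ₜ b)) := by
  refine H.nondegenerate.eq_of_mul_tmul fun u v => ?_
  have : ∀ t : A ⊗[K] A, (LinearMap.mulRight K x).rTensor A t * (u ⊗ₜ[K] v) =
      t * ((x * u) ⊗ₜ[K] v) := by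
    intro t
    induction t with
    | zero => simp
    | tmul p q => simp [mul_assoc]
    | add p q hp hq => simp only [map_add, add_mul, hp, hq]
  rw [this, T₁_mul_tmul, ← comulLeft_mul]
  simp

theorem mulRight_lTensor_mul_tmul (c u v : A) (t : A ⊗[K] A) :
    (LinearMap.mulRight K c).lTensor A t * (u ⊗ₜ[K] v) = t * (u ⊗ₜ[K] (c * v)) := by
  induction t with
  | zero => simp
  | tmul p q => simp [mul_assoc]
  | add p q hp hq => simp only [map_add, add_mul, hp, hq]

theorem T₁_mul_right (a b c : A) :
    H.T₁ (a ⊗ₜ (b * c)) = (LinearMap.mulRight K c).lTensor A (H.T₁ (a ⊗ₜ b)) := by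
  refine H.nondegenerate.eq_of_mul_tmul fun u v => ?_
  rw [mulRight_lTensor_mul_tmul, T₁_mul_tmul, T₁_mul_tmul]
  simp

/-- `Δ(a a')(1 ⊗ b) = Δ(a)(Δ(a')(1 ⊗ b))`. -/
theorem T₁_mul_left (a a' b : A) :
    H.T₁ ((a * a') ⊗ₜ b) = H.comulLeft a (H.T₁ (a' ⊗ₜ b)) := by
  refine H.nondegenerate.eq_of_mul_tmul fun u v => ?_
  rw [← comulLeft_mul, T₁_mul_tmul, T₁_mul_tmul, comulLeft_comp]

/-- `(c ⊗ 1)(Δ(a)(1 ⊗ y)) = ((c ⊗ 1)Δ(a))(1 ⊗ y)`. -/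
theorem rTensor_T₁_eq_lTensor_T₂ (a c y : A) :
    (LinearMap.mulLeft K c).rTensor A (H.T₁ (a ⊗ₜ y)) =
      (LinearMap.mulRight K y).lTensor A (H.T₂ (c ⊗ₜ a)) := by
  refine H.nondegenerate.eq_of_mul_tmul fun u v => ?_
  have h1 : ∀ t : A ⊗[K] A, (LinearMap.mulLeft K c).rTensor A t * (u ⊗ₜ[K] v) =
      (LinearMap.mulLeft K c).rTensor A (t * (u ⊗ₜ[K] v)) := by
    intro t
    induction t with
    | zero => simp
    | tmul p q => simp [mul_assoc]
    | add p q hp hq => simp only [map_add, add_mul, hp, hq]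
  rw [h1, mulRight_lTensor_mul_tmul, T₁_mul_tmul, T₂_mul_tmul]
  simp

end MultiplierHopfAlgebra

/-! ### The counit -/

theorem eq_of_forall_smul_eq {K V : Type*} [Field K] [AddCommGroup V] [Module K V] {r s : K}
    (h : ∀ x : V, r • x = s • x) (hV : ∃ x : V, x ≠ 0) : r = s := by
  obtain ⟨x, hx⟩ := hV
  exact smul_left_injective K hx (h x)

namespace MultiplierHopfAlgebra

variable {K : Type*} [Field K] {A : Type*} [NonUnitalRing A] [Module K A]
  [IsScalarTower K A A] [SMulCommClass K A A] (H : MultiplierHopfAlgebra K A)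

/-- The step in which coassociativity enters the construction of the counit:
`(ι ⊗ E)((a ⊗ 1)Δ(p) ⊗ q) = a p ⊗ q` for `E = m T₁⁻¹`. -/
theorem lTensor_mul_T₁_symm (a : A) (t : A ⊗[K] A) :
    (LinearMap.mul' K A ∘ₗ H.T₁.symm.toLinearMap).lTensor A
      (TensorProduct.assoc K A A A (H.T₂.toLinearMap.rTensor A
        ((TensorProduct.assoc K A A A).symm (a ⊗ₜ t)))) =
      (LinearMap.mulLeft K a).rTensor A t := by
  obtain ⟨t, rfl⟩ := H.T₁.surjective t
  induction t with
  | zero => simp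
  | add x y hx hy => simp only [map_add, tmul_add, hx, hy]
  | tmul b c =>
    rw [H.coassoc, rTensor_T₁_eq_lTensor_T₂, ← LinearMap.comp_apply, ← LinearMap.lTensor_comp]
    have : (LinearMap.mul' K A ∘ₗ H.T₁.symm.toLinearMap) ∘ₗ H.T₁.toLinearMap =
        LinearMap.mul' K A := by ext; simp
    rw [this]
    generalize H.T₂ (a ⊗ₜ b) = t
    induction t with
    | zero => simp
    | tmul p q => simp
    | add x y hx hy => simp only [map_add, add_tmul, hx, hy]

theorem tmul_mul_T₁_symm (x y q : A) :
    x ⊗ₜ[K] LinearMap.mul' K A (H.T₁.symm (y ⊗ₜ q)) =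
      LinearMap.mul' K A (H.T₂.symm (x ⊗ₜ y)) ⊗ₜ q := by
  have key : ∀ t : A ⊗[K] A, (LinearMap.mul' K A ∘ₗ H.T₁.symm.toLinearMap).lTensor A
      (TensorProduct.assoc K A A A (H.T₂ t ⊗ₜ q)) = LinearMap.mul' K A t ⊗ₜ q := by
    intro t
    induction t with
    | zero => simp
    | tmul p r => simpa using H.lTensor_mul_T₁_symm p (r ⊗ₜ q)
    | add x y hx hy => simp only [map_add, add_tmul, hx, hy]
  simpa using key (H.T₂.symm (x ⊗ₜ y))

theorem exists_isCounit : ∃ ε : A →ₗ[K] K, H.IsCounit ε := by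
  rcases subsingleton_or_nontrivial A with hA | hA
  · exact ⟨0, fun a b => Subsingleton.elim _ _, fun a b => Subsingleton.elim _ _⟩
  obtain ⟨x₀, hx₀⟩ := exists_ne (0 : A)
  obtain ⟨f, hf⟩ := Module.Projective.exists_dual_ne_zero K hx₀
  -- by `tmul_mul_T₁_symm`, `m T₁⁻¹ (y ⊗ q)` is a multiple of `q`, with a factor independent of `q`
  let ε : A →ₗ[K] K := (f x₀)⁻¹ • (f ∘ₗ LinearMap.mul' K A ∘ₗ H.T₂.symm.toLinearMap ∘ₗ
    TensorProduct.mk K A A x₀)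
  have h1 : ∀ y q : A, LinearMap.mul' K A (H.T₁.symm (y ⊗ₜ q)) = ε y • q := by
    intro y q
    have := congrArg (sliceLeft f) (H.tmul_mul_T₁_symm x₀ y q)
    rw [sliceLeft_tmul, sliceLeft_tmul] at this
    rw [← inv_smul_smul₀ hf (LinearMap.mul' K A (H.T₁.symm (y ⊗ₜ q))), this, smul_smul]
    rfl
  have h2 : ∀ x y : A, LinearMap.mul' K A (H.T₂.symm (x ⊗ₜ y)) = ε y • x := by
    intro x y
    have := congrArg (sliceRight f) (H.tmul_mul_T₁_symm x y x₀)
    rw [sliceRight_tmul, sliceRight_tmul, h1, map_smul, smul_eq_mul, mul_comm, mul_smul] at this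
    exact ((smul_right_injective A hf) this).symm
  refine ⟨ε, fun a b => ?_, fun a b => ?_⟩
  · have : ∀ t : A ⊗[K] A,
        LinearMap.mul' K A (H.T₁.symm t) = TensorProduct.lid K A (ε.rTensor A t) := by
      intro t
      induction t with
      | zero => simp
      | tmul p q => simp [h1]
      | add x y hx hy => simp only [map_add, hx, hy]
    rw [← this]; simp
  · have : ∀ t : A ⊗[K] A,
        LinearMap.mul' K A (H.T₂.symm t) = TensorProduct.rid K A (ε.lTensor A t) := by
      intro t
      induction t with
      | zero => simp
      | tmul p q => simp [h2]
      | add x y hx hy => simp only [map_add, hx, hy]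
    rw [← this]; simp

variable {H} {ε : A →ₗ[K] K}

theorem IsCounit.sliceLeft_T₁ (h : H.IsCounit ε) (t : A ⊗[K] A) :
    sliceLeft ε (H.T₁ t) = LinearMap.mul' K A t := by
  induction t with
  | zero => simp
  | tmul a b => simpa [sliceLeft] using h.1 a b
  | add x y hx hy => simp only [map_add, hx, hy]

theorem IsCounit.sliceRight_T₂ (h : H.IsCounit ε) (t : A ⊗[K] A) :
    sliceRight ε (H.T₂ t) = LinearMap.mul' K A t := by
  induction t with
  | zero => simp
  | tmul a b => simpa [sliceRight] using h.2 a b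
  | add x y hx hy => simp only [map_add, hx, hy]

/-- `ε(x₍₁₎ p) x₍₂₎ q = x (ε(p) q)`, which contains the multiplicativity of `ε`. -/
theorem IsCounit.sliceLeft_comulLeft (h : H.IsCounit ε) (x : A) (t : A ⊗[K] A) :
    sliceLeft ε (H.comulLeft x t) = x * sliceLeft ε t := by
  obtain ⟨t, rfl⟩ := H.T₁.surjective t
  induction t with
  | zero => simp
  | tmul a b => rw [← T₁_mul_left, h.sliceLeft_T₁, h.sliceLeft_T₁]; simp [mul_assoc]
  | add x y hx hy => simp only [map_add, mul_add, hx, hy]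

theorem IsCounit.map_mul_smul (h : H.IsCounit ε) (a a' x : A) :
    ε (a * a') • x = (ε a * ε a') • x := by
  have key : ∀ t : A ⊗[K] A, sliceLeft ε ((LinearMap.mulRight K a').rTensor A t) =
      ε a' • sliceLeft ε t := by
    intro t
    obtain ⟨t, rfl⟩ := H.T₁.surjective t
    induction t with
    | zero => simp
    | tmul p q =>
      rw [← comulLeft_tmul, h.sliceLeft_comulLeft, h.sliceLeft_T₁]; simp [mul_smul_comm]
    | add x y hx hy => simp only [map_add, smul_add, hx, hy]
  simpa [mul_smul, smul_comm (ε a) (ε a')] using key (a ⊗ₜ x)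

theorem IsCounit.map_mul (h : H.IsCounit ε) (a a' : A) : ε (a * a') = ε a * ε a' := by
  by_cases hA : ∃ x : A, x ≠ 0
  · exact eq_of_forall_smul_eq (h.map_mul_smul a a') hA
  · push Not at hA
    simp [hA a]

theorem IsCounit.unique {ε' : A →ₗ[K] K} (h : H.IsCounit ε)
    (h' : ∀ t : A ⊗[K] A, sliceRight ε' (H.T₂ t) = LinearMap.mul' K A t) : ε = ε' := by
  ext y
  by_cases hA : ∃ x : A, x ≠ 0
  · refine eq_of_forall_smul_eq (fun x => ?_) hA
    rw [← sliceRight_tmul, ← sliceRight_tmul, ← H.T₂.apply_symm_apply (x ⊗ₜ y),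
      h.sliceRight_T₂, h']
  · push Not at hA
    simp [hA y]

theorem mul'_surjective (H : MultiplierHopfAlgebra K A) :
    Function.Surjective (LinearMap.mul' K A) := by
  obtain ⟨ε, h⟩ := H.exists_isCounit
  intro a
  by_cases hε : ε = 0
  · have h0 : ∀ x y : A, x * y = 0 := fun x y => by
      rw [← LinearMap.mul'_apply (R := K), ← h.sliceLeft_T₁, hε]; simp [sliceLeft]
    exact ⟨0, by rw [map_zero, H.nondegenerate.1 a (h0 a)]⟩
  · obtain ⟨p, hp⟩ : ∃ p, ε p ≠ 0 := by
      by_contra! hc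
      exact hε (LinearMap.ext hc)
    refine ⟨H.T₁.symm (((ε p)⁻¹ • p) ⊗ₜ a), ?_⟩
    rw [← h.sliceLeft_T₁]; simp [hp]

/-! ### The antipode -/

/-- The linear map `s (a ⊗ b) = S(a) b`, defined through `s (a₍₁₎ ⊗ a₍₂₎ b) = ε(a) b`. -/
noncomputable def antipodeMul (H : MultiplierHopfAlgebra K A) (ε : A →ₗ[K] K) :
    A ⊗[K] A →ₗ[K] A := sliceLeft ε ∘ₗ H.T₁.symm.toLinearMap

theorem antipodeMul_T₁ (t : A ⊗[K] A) : H.antipodeMul ε (H.T₁ t) = sliceLeft ε t := by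
  simp [antipodeMul]

theorem antipodeMul_lTensor (c : A) (t : A ⊗[K] A) :
    H.antipodeMul ε ((LinearMap.mulRight K c).lTensor A t) = H.antipodeMul ε t * c := by
  obtain ⟨t, rfl⟩ := H.T₁.surjective t
  induction t with
  | zero => simp
  | tmul p q => rw [← T₁_mul_right, antipodeMul_T₁, antipodeMul_T₁]; simp [smul_mul_assoc]
  | add x y hx hy => simp only [map_add, add_mul, hx, hy]

theorem IsCounit.antipodeMul_comulLeft (h : H.IsCounit ε) (x : A) (t : A ⊗[K] A) :
    H.antipodeMul ε (H.comulLeft x t) = ε x • H.antipodeMul ε t := by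
  obtain ⟨t, rfl⟩ := H.T₁.surjective t
  induction t with
  | zero => simp
  | tmul p q =>
    rw [← T₁_mul_left, antipodeMul_T₁, antipodeMul_T₁, sliceLeft_tmul, sliceLeft_tmul, h.map_mul,
      mul_smul]
  | add x y hx hy => simp only [map_add, smul_add, hx, hy]

theorem IsCounit.antipodeMul_surjective (h : H.IsCounit ε) :
    Function.Surjective (H.antipodeMul ε) := by
  intro a
  by_cases hε : ε = 0
  · have h0 : ∀ x y : A, x * y = 0 := fun x y => by
      rw [← LinearMap.mul'_apply (R := K), ← h.sliceLeft_T₁, hε]; simp [sliceLeft]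
    exact ⟨0, by rw [map_zero, H.nondegenerate.1 a (h0 a)]⟩
  · obtain ⟨p, hp⟩ : ∃ p, ε p ≠ 0 := by
      by_contra! hc
      exact hε (LinearMap.ext hc)
    refine ⟨H.T₁ (((ε p)⁻¹ • p) ⊗ₜ a), ?_⟩
    rw [antipodeMul_T₁]; simp [hp]

/-- A bijection `S` with `S(a) b = s (a ⊗ b)` is an antipode: the identity
`a b₍₁₎ S(b₍₂₎) = ε(b) a` follows from coassociativity. -/
theorem IsCounit.isAntipode (h : H.IsCounit ε) (S : A ≃ₗ[K] A)
    (hS : ∀ a b, S a * b = H.antipodeMul ε (a ⊗ₜ b)) : H.IsAntipode S := by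
  have hS' : ∀ t : A ⊗[K] A, LinearMap.mul' K A (S.toLinearMap.rTensor A t) =
      H.antipodeMul ε t := by
    intro t
    induction t with
    | zero => simp
    | tmul p q => simp [hS]
    | add x y hx hy => simp only [map_add, hx, hy]
  refine ⟨ε, h, fun a b => ?_, fun a b => H.eq_of_mul_eq fun c => ?_⟩
  · rw [hS', antipodeMul_T₁, sliceLeft_tmul]
  · -- `(ι ⊗ s)((a ⊗ 1)Δ(b) ⊗ c)`, computed by means of `T₁⁻¹ (b ⊗ c)`
    have h1 : ∀ t : A ⊗[K] A, LinearMap.mul' K A (S.toLinearMap.lTensor A t) * c =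
        LinearMap.mul' K A ((H.antipodeMul ε).lTensor A
          (TensorProduct.assoc K A A A (t ⊗ₜ c))) := by
      intro t
      induction t with
      | zero => simp
      | tmul p q => simp [← hS, mul_assoc]
      | add x y hx hy => simp only [map_add, add_mul, add_tmul, hx, hy]
    have h2 : ∀ t : A ⊗[K] A, (H.antipodeMul ε).lTensor A (TensorProduct.assoc K A A A
        (H.T₂.toLinearMap.rTensor A ((TensorProduct.assoc K A A A).symm (a ⊗ₜ H.T₁ t)))) =
          (LinearMap.mulLeft K a).rTensor A t := by
      intro t
      induction t with
      | zero => simp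
      | add x y hx hy => simp only [map_add, tmul_add, hx, hy]
      | tmul p q =>
        rw [H.coassoc, ← LinearMap.comp_apply, ← LinearMap.lTensor_comp]
        have : H.antipodeMul ε ∘ₗ H.T₁.toLinearMap = sliceLeft ε := by
          ext; simp [antipodeMul_T₁]
        rw [this]
        have h3 : ∀ t : A ⊗[K] A, (sliceLeft ε).lTensor A
            (TensorProduct.assoc K A A A (t ⊗ₜ q)) = sliceRight ε t ⊗ₜ[K] q := by
          intro t
          induction t with
          | zero => simp
          | tmul x y => simp [smul_tmul]
          | add x y hx hy => simp only [map_add, add_tmul, hx, hy]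
        rw [h3, h.sliceRight_T₂]; simp
    have h4 := h2 (H.T₁.symm (b ⊗ₜ c))
    rw [LinearEquiv.apply_symm_apply] at h4
    have h5 : ∀ t : A ⊗[K] A, LinearMap.mul' K A ((LinearMap.mulLeft K a).rTensor A t) =
        a * sliceLeft ε (H.T₁ t) := by
      intro t
      rw [h.sliceLeft_T₁]
      induction t with
      | zero => simp
      | tmul x y => simp [mul_assoc]
      | add x y hx hy => simp only [map_add, mul_add, hx, hy]
    rw [h1]
    simp only [assoc_symm_tmul, LinearMap.rTensor_tmul, LinearEquiv.coe_coe] at h4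
    rw [h4, h5]; simp [mul_smul_comm, smul_mul_assoc]

theorem IsAntipode.exists_mul_eq {S : A ≃ₗ[K] A} (hS : H.IsAntipode S) :
    ∃ ε, H.IsCounit ε ∧ ∀ a b, S a * b = H.antipodeMul ε (a ⊗ₜ b) := by
  obtain ⟨ε, h, h1, h2⟩ := hS
  refine ⟨ε, h, fun a b => ?_⟩
  have : ∀ t : A ⊗[K] A, LinearMap.mul' K A (S.toLinearMap.rTensor A (H.T₁ t)) =
      sliceLeft ε t := by
    intro t
    induction t with
    | zero => simp
    | tmul p q => simpa using h1 p q
    | add x y hx hy => simp only [map_add, hx, hy]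
  simpa [antipodeMul] using this (H.T₁.symm (a ⊗ₜ b))

theorem IsAntipode.unique {S S' : A ≃ₗ[K] A} (hS : H.IsAntipode S) (hS' : H.IsAntipode S') :
    S = S' := by
  obtain ⟨ε, h, h1⟩ := hS.exists_mul_eq
  obtain ⟨ε', h', h1'⟩ := hS'.exists_mul_eq
  obtain rfl := h.unique h'.sliceRight_T₂
  ext a
  exact H.eq_of_mul_eq fun z => by rw [h1, h1']

theorem IsAntipode.map_mul {S : A ≃ₗ[K] A} (hS : H.IsAntipode S) (a b : A) :
    S (a * b) = S b * S a := by
  obtain ⟨ε, h, h1⟩ := hS.exists_mul_eq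
  refine H.eq_of_mul_eq fun c => ?_
  have key : ∀ t : A ⊗[K] A, H.antipodeMul ε ((LinearMap.mulRight K b).rTensor A t) =
      S b * H.antipodeMul ε t := by
    intro t
    obtain ⟨t, rfl⟩ := H.T₁.surjective t
    induction t with
    | zero => simp
    | tmul p q =>
      rw [← comulLeft_tmul, h.antipodeMul_comulLeft, antipodeMul_T₁, sliceLeft_tmul,
        mul_smul_comm, h1]
    | add x y hx hy => simp only [map_add, mul_add, hx, hy]
  have := key (a ⊗ₜ c)
  rw [LinearMap.rTensor_tmul, LinearMap.mulRight_apply, ← h1, ← h1] at this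
  rw [this, mul_assoc]

end MultiplierHopfAlgebra

namespace RegularMultiplierHopfAlgebra

variable {K : Type*} [Field K] {A : Type*} [NonUnitalRing A] [Module K A]
  [IsScalarTower K A A] [SMulCommClass K A A] (H : RegularMultiplierHopfAlgebra K A)

open MultiplierHopfAlgebra

theorem cop_comulLeft (a : A) (t : A ⊗[K] A) :
    H.cop.comulLeft a t =
      TensorProduct.comm K A A (H.comulLeft a (TensorProduct.comm K A A t)) := by
  simp [comulLeft, H.cop_comul, Multiplier.left, Multiplier.flip]

/-- The co-opposite regular multiplier Hopf algebra `(A, Δᶜᵒᵖ)`. -/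
noncomputable def coop : RegularMultiplierHopfAlgebra K A where
  toMultiplierHopfAlgebra := H.cop
  cop := H.toMultiplierHopfAlgebra
  cop_comul a := by
    rw [H.cop_comul]
    apply Subtype.ext
    apply Prod.ext
    · ext; simp [Multiplier.flip, Multiplier.left]
    · apply MulOpposite.unop_injective
      ext; simp [Multiplier.flip, Multiplier.right]

/-- `a₍₁₎ x ⊗ a₍₂₎ y`, computed from `Δᶜᵒᵖ(a)(1 ⊗ x)`. -/
theorem comulLeft_tmul_cop (a x y : A) :
    H.comulLeft a (x ⊗ₜ y) =
      (LinearMap.mulRight K y).lTensor A (TensorProduct.comm K A A (H.cop.T₁ (a ⊗ₜ x))) := by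
  have := H.cop.comulLeft_tmul a y x
  rw [H.cop_comulLeft] at this
  have := congrArg (TensorProduct.comm K A A) this
  have h2 : ∀ t : A ⊗[K] A, TensorProduct.comm K A A (TensorProduct.comm K A A t) = t :=
    fun t => (TensorProduct.comm K A A).symm_apply_apply t
  rw [h2, comm_tmul] at this
  rw [this]
  generalize H.cop.T₁ (a ⊗ₜ x) = t
  induction t with
  | zero => simp
  | tmul p q => simp
  | add x y hx hy => simp only [map_add, hx, hy]

theorem cop_isCounit_eq {ε ε' : A →ₗ[K] K} (h : H.IsCounit ε) (h' : H.cop.IsCounit ε') :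
    ε = ε' := by
  refine h.unique fun t => ?_
  induction t with
  | zero => simp
  | add x y hx hy => simp only [map_add, hx, hy]
  | tmul c a =>
    -- compare after multiplication by `x ⊗ y` from the right
    have key : ∀ (t : A ⊗[K] A) (x y : A), sliceRight ε' (t * (x ⊗ₜ[K] y)) =
        ε' y • (sliceRight ε' t * x) := by
      intro t x y
      induction t with
      | zero => simp
      | tmul p q => simp [h'.map_mul, mul_smul, smul_mul_assoc, smul_comm (ε' q)]
      | add p q hp hq => simp only [map_add, add_mul, smul_add, hp, hq]
    by_cases hε : ε' = 0
    · have h0 : ∀ x y : A, x * y = 0 := fun x y => by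
        rw [← LinearMap.mul'_apply (R := K), ← h'.sliceLeft_T₁, hε]; simp [sliceLeft]
      have h1 : ∀ x : A, x = 0 := fun x => H.nondegenerate.1 x (h0 x)
      rw [h1 (sliceRight _ _), h1 (LinearMap.mul' K A _)]
    · obtain ⟨y, hy⟩ : ∃ p, ε' p ≠ 0 := by
        by_contra! hc
        exact hε (LinearMap.ext hc)
      refine H.eq_of_mul_eq fun x => smul_right_injective A hy ?_
      have h2 : ∀ t : A ⊗[K] A, sliceRight ε' ((LinearMap.mulRight K y).lTensor A t) =
          ε' y • sliceRight ε' t := by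
        intro t
        induction t with
        | zero => simp
        | tmul p q => simp [h'.map_mul, mul_smul, smul_comm (ε' q)]
        | add p q hp hq => simp only [map_add, smul_add, hp, hq]
      have h3 := key (H.T₂ (c ⊗ₜ a)) x y
      rw [T₂_mul_tmul, sliceRight_rTensor, comulLeft_tmul_cop, h2, sliceRight_comm,
        h'.sliceLeft_T₁] at h3
      simp only [← h3]
      simp [mul_assoc]

theorem antipodeMul_cop {ε : A →ₗ[K] K} (h : H.IsCounit ε)
    (t : A ⊗[K] A) (c : A) :
    H.antipodeMul ε (H.cop.antipodeMul ε t ⊗ₜ c) =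
      H.antipodeMul ε (TensorProduct.comm K A A t) * c := by
  obtain ⟨t, rfl⟩ := H.cop.T₁.surjective t
  induction t with
  | zero => simp
  | tmul x y =>
    rw [← antipodeMul_lTensor, ← comulLeft_tmul_cop, antipodeMul_T₁, h.antipodeMul_comulLeft]
    simp [← smul_tmul']
  | add x y hx hy => simp only [map_add, add_mul, add_tmul, hx, hy]

/-- The kernels of `a ⊗ b ↦ S(a) b` and of `a ⊗ b ↦ S⁻¹(b) a` agree, because of
`S(S⁻¹(b) a) = S(a) b`. -/
theorem antipodeMul_eq_zero_of_cop {ε : A →ₗ[K] K} (h : H.IsCounit ε)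
    (t : A ⊗[K] A) (ht : H.cop.antipodeMul ε (TensorProduct.comm K A A t) = 0) :
    H.antipodeMul ε t = 0 := by
  refine H.nondegenerate.1 _ fun c => ?_
  have := H.antipodeMul_cop h (TensorProduct.comm K A A t) c
  rw [ht, zero_tmul, map_zero] at this
  have h2 : TensorProduct.comm K A A (TensorProduct.comm K A A t) = t :=
    (TensorProduct.comm K A A).symm_apply_apply t
  rw [h2] at this
  exact this.symm

/-- Existence of the antipode of a regular multiplier Hopf algebra `A`, as a bijection of `A` whose
inverse is the antipode of `(A, Δᶜᵒᵖ)`. It is determined by `S(S⁻¹(b) a) = S(a) b`, where both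
sides are defined by means of the counit. -/
theorem exists_isAntipode : ∃ S : A ≃ₗ[K] A, H.IsAntipode S ∧ H.cop.IsAntipode S.symm := by
  obtain ⟨ε, h⟩ := H.exists_isCounit
  obtain ⟨ε', h'⟩ := H.cop.exists_isCounit
  obtain rfl := H.cop_isCounit_eq h h'
  set s := H.antipodeMul ε with hs
  set s' := H.cop.antipodeMul ε ∘ₗ (TensorProduct.comm K A A).toLinearMap with hs'
  have hss : Function.Surjective s := h.antipodeMul_surjective
  have hss' : Function.Surjective s' :=
    h'.antipodeMul_surjective.comp (TensorProduct.comm K A A).surjective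
  have hker : LinearMap.ker s = LinearMap.ker s' := by
    ext t
    refine ⟨fun ht => ?_, fun ht => H.antipodeMul_eq_zero_of_cop h t ht⟩
    have h2 : TensorProduct.comm K A A (TensorProduct.comm K A A t) = t :=
      (TensorProduct.comm K A A).symm_apply_apply t
    refine H.coop.antipodeMul_eq_zero_of_cop h' (TensorProduct.comm K A A t) ?_
    rw [h2]
    exact ht
  -- `S` maps `s' t = S⁻¹(b) a` to `s t = S(a) b`, for `t = a ⊗ b`
  let S : A ≃ₗ[K] A := (s'.quotKerEquivOfSurjective hss').symm ≪≫ₗ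
    Submodule.quotEquivOfEq _ _ hker.symm ≪≫ₗ s.quotKerEquivOfSurjective hss
  have hS : ∀ t, S (s' t) = s t := by
    intro t
    have : (s'.quotKerEquivOfSurjective hss').symm (s' t) = Submodule.Quotient.mk t := by
      rw [LinearEquiv.symm_apply_eq]; rfl
    simp only [S, LinearEquiv.trans_apply, this]
    rfl
  have hS' : ∀ t, S.symm (s t) = s' t := fun t => by rw [← hS, LinearEquiv.symm_apply_apply]
  refine ⟨S, h.isAntipode S fun a b => ?_, h'.isAntipode S.symm fun a b => ?_⟩
  · obtain ⟨t, rfl⟩ := hss' a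
    rw [hS, hs', LinearMap.comp_apply, LinearEquiv.coe_coe, H.antipodeMul_cop h]
    congr 2
    exact ((TensorProduct.comm K A A).symm_apply_apply t).symm
  · obtain ⟨t, rfl⟩ := hss a
    rw [hS']
    exact (H.coop.antipodeMul_cop h' t b).symm

theorem isAntipode_antipode : H.IsAntipode H.antipode :=
  Classical.epsilon_spec (p := H.IsAntipode) (H.exists_isAntipode.imp fun _ h => h.1)

theorem cop_isAntipode_antipode_symm : H.cop.IsAntipode H.antipode.symm := by
  obtain ⟨S, hS, hS'⟩ := H.exists_isAntipode
  rwa [H.isAntipode_antipode.unique hS]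

end RegularMultiplierHopfAlgebra

/-! ### A multiplier Hopf algebra with a dual space acting on it -/

/-- One side of a pairing of multiplier Hopf algebras, as seen from the algebra `A`: a space `E`
with a product `mu`, paired with `A`, such that `l e a = ⟨a₍₁₎, e⟩ a₍₂₎` and
`r e a = ⟨a₍₂₎, e⟩ a₍₁₎` lie in `A`. The product of `E` is dual to `Δ`, which makes `A` an
`E`-bimodule, and `k a e` represents the linear form `⟨· a, e⟩`. The product of `E` is a
bilinear map rather than an instance, because the passage from `Δ` to `Δᶜᵒᵖ` reverses it. The form
is only required to separate the points of `A`. -/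
structure DualActions {K : Type*} [Field K] {A : Type*} [NonUnitalRing A] [Module K A]
    [IsScalarTower K A A] [SMulCommClass K A A] (H : MultiplierHopfAlgebra K A)
    (E : Type*) [AddCommGroup E] [Module K E] where
  form : A →ₗ[K] E →ₗ[K] K
  eq_zero : ∀ a, (∀ e, form a e = 0) → a = 0
  mu : E →ₗ[K] E →ₗ[K] E
  mu_assoc : ∀ e e' e'', mu (mu e e') e'' = mu e (mu e' e'')
  l : E →ₗ[K] A →ₗ[K] A
  r : E →ₗ[K] A →ₗ[K] A
  k : A →ₗ[K] E →ₗ[K] E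
  sliceLeft_T₁ : ∀ e a x, sliceLeft (form.flip e) (H.T₁ (a ⊗ₜ x)) = l e a * x
  form_l : ∀ e a e', form (l e a) e' = form a (mu e e')
  form_r : ∀ e a e', form (r e a) e' = form a (mu e' e)
  form_mul : ∀ a c e, form (a * c) e = form a (k c e)

namespace DualActions

variable {K : Type*} [Field K] {A : Type*} [NonUnitalRing A] [Module K A]
  [IsScalarTower K A A] [SMulCommClass K A A] {H : MultiplierHopfAlgebra K A}
  {E : Type*} [AddCommGroup E] [Module K E] (d : DualActions H E)
  {V W : Type*} [AddCommGroup V] [Module K V] [AddCommGroup W] [Module K W]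

theorem ext_form {a a' : A} (h : ∀ e, d.form a e = d.form a' e) : a = a' := by
  refine sub_eq_zero.mp (d.eq_zero _ fun e => ?_)
  rw [map_sub, LinearMap.sub_apply, h e, sub_self]

theorem ext_right {t t' : W ⊗[K] A}
    (h : ∀ e, sliceRight (d.form.flip e) t = sliceRight (d.form.flip e) t') : t = t' :=
  ext_sliceRight (fun e => d.form.flip e) d.eq_zero h

theorem ext_left {t t' : A ⊗[K] W}
    (h : ∀ e, sliceLeft (d.form.flip e) t = sliceLeft (d.form.flip e) t') : t = t' :=
  ext_sliceLeft (fun e => d.form.flip e) d.eq_zero h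

theorem flip_comp_r (e e' : E) : d.form.flip e' ∘ₗ d.r e = d.form.flip (d.mu e' e) := by
  ext a; exact d.form_r e a e'

theorem flip_comp_mulRight (c : A) (e : E) :
    d.form.flip e ∘ₗ LinearMap.mulRight K c = d.form.flip (d.k c e) := by
  ext a; exact d.form_mul a c e

theorem r_r (e e' : E) (a : A) : d.r e (d.r e' a) = d.r (d.mu e e') a :=
  d.ext_form fun x => by rw [form_r, form_r, form_r, mu_assoc]

theorem l_l (e e' : E) (a : A) : d.l e (d.l e' a) = d.l (d.mu e' e) a :=
  d.ext_form fun x => by rw [form_l, form_l, form_l, mu_assoc]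

theorem l_r (e e' : E) (a : A) : d.l e (d.r e' a) = d.r e' (d.l e a) :=
  d.ext_form fun x => by rw [form_l, form_r, form_r, form_l, mu_assoc]

theorem sliceRight_T₁ (e : E) (a c : A) :
    sliceRight (d.form.flip e) (H.T₁ (a ⊗ₜ c)) = d.r (d.k c e) a := by
  refine d.ext_form fun x => ?_
  have := apply_sliceLeft (d.form.flip x) (d.form.flip e) (H.T₁ (a ⊗ₜ c))
  rw [sliceLeft_T₁] at this
  simp only [LinearMap.flip_apply] at this
  rw [← this, form_mul, form_l, form_r]

/-- Coassociativity, with a form applied to the first leg of `a₍₁₎ ⊗ a₍₂₎ ⊗ a₍₃₎ c`. -/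
theorem T₁_l (e : E) (a c : A) :
    H.T₁ (d.l e a ⊗ₜ c) = (d.l e).rTensor A (H.T₁ (a ⊗ₜ c)) := by
  refine d.ext_right fun x => ?_
  rw [sliceRight_rTensor, sliceRight_T₁, sliceRight_T₁, l_r]

/-- Both the bijectivity of `T₁` and the regularity of the pairing enter: `x ⟨y, e⟩` is a sum of
elements `r (k c e) a` for `x ⊗ y = ∑ T₁ (a ⊗ c)`. -/
theorem span_r : Submodule.span K {x : A | ∃ e a, d.r e a = x} = ⊤ := by
  rw [eq_top_iff]
  intro x _
  by_cases hA : ∃ y : A, y ≠ 0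
  · obtain ⟨y, hy⟩ := hA
    obtain ⟨e, he⟩ : ∃ e, d.form y e ≠ 0 := by
      by_contra! hc
      exact hy (d.eq_zero y hc)
    have key : ∀ t, sliceRight (d.form.flip e) (H.T₁ t) ∈
        Submodule.span K {x : A | ∃ e a, d.r e a = x} := by
      intro t
      induction t with
      | zero => simp
      | tmul a c => rw [sliceRight_T₁]; exact Submodule.subset_span ⟨_, _, rfl⟩
      | add s t hs ht => rw [map_add, map_add]; exact Submodule.add_mem _ hs ht
    have := key (H.T₁.symm (x ⊗ₜ ((d.form y e)⁻¹ • y)))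
    simpa [he] using this
  · push Not at hA
    rw [hA x]; exact Submodule.zero_mem _

/-- Linear maps agreeing on all `r e a` are equal. -/
theorem eq_of_r {f g : A →ₗ[K] V} (h : ∀ e a, f (d.r e a) = g (d.r e a)) (a : A) :
    f a = g a := by
  have : f = g := LinearMap.ext_on (d.span_r) (by rintro _ ⟨e, a, rfl⟩; exact h e a)
  rw [this]

/-- The elements `k a e` span `E`. -/
def KSpans : Prop := Submodule.span K {x : E | ∃ a e, d.k a e = x} = ⊤

variable {d}

/-- Linear maps agreeing on all `k a e` are equal. -/
theorem KSpans.eq (hk : d.KSpans) {f g : E →ₗ[K] V}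
    (h : ∀ a e, f (d.k a e) = g (d.k a e)) (e : E) : f e = g e := by
  have : f = g := LinearMap.ext_on hk (by rintro _ ⟨a, e, rfl⟩; exact h a e)
  rw [this]

variable (d)

theorem counit_r (hk : d.KSpans) {ε : A →ₗ[K] K} (h : H.IsCounit ε) (e : E) (a : A) :
    ε (d.r e a) = d.form a e := by
  refine hk.eq (f := ε ∘ₗ d.r.flip a) (g := d.form a) (fun c e => ?_) e
  rw [LinearMap.comp_apply, LinearMap.flip_apply, ← sliceRight_T₁, ← apply_sliceLeft,
    h.sliceLeft_T₁, LinearMap.mul'_apply, LinearMap.flip_apply, form_mul]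

theorem exists_slices (t : W ⊗[K] A) :
    ∃ F : E →ₗ[K] W, ∀ e, F e = sliceRight (d.form.flip e) t := by
  induction t with
  | zero => exact ⟨0, by simp⟩
  | tmul x y => exact ⟨(d.form y).smulRight x, by simp⟩
  | add x y hx hy =>
    obtain ⟨F, hF⟩ := hx
    obtain ⟨G, hG⟩ := hy
    exact ⟨F + G, fun e => by rw [LinearMap.add_apply, hF, hG, map_add]⟩

/-- `(ι ⊗ ⟨·, e⟩)((c ⊗ 1)Δ(a)) = c ⟨a₍₂₎, e⟩ a₍₁₎`. -/
theorem sliceRight_T₂ (hk : d.KSpans) (e : E) (c a : A) :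
    sliceRight (d.form.flip e) (H.T₂ (c ⊗ₜ a)) = c * d.r e a := by
  obtain ⟨F, hF⟩ := d.exists_slices (H.T₂ (c ⊗ₜ a))
  rw [← hF]
  refine hk.eq (g := LinearMap.mulLeft K c ∘ₗ d.r.flip a) (fun y e => ?_) e
  rw [hF, ← flip_comp_mulRight, ← sliceRight_lTensor, ← H.rTensor_T₁_eq_lTensor_T₂,
    sliceRight_rTensor, sliceRight_T₁]
  rfl

/-! ### Legs -/

/-- The slices of `f(a₍₁₎, v) ⊗ a₍₂₎` are `f(r e a, v)`. -/
theorem isLeg_iff (hk : d.KSpans) {f : A →ₗ[K] V →ₗ[K] W} {Θ : A →ₗ[K] V →ₗ[K] W ⊗[K] A} :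
    H.IsLeg f Θ ↔ ∀ e a v, sliceRight (d.form.flip e) (Θ a v) = f (d.r e a) v := by
  constructor
  · intro h e a v
    obtain ⟨F, hF⟩ := d.exists_slices (Θ a v)
    rw [← hF]
    refine hk.eq (g := f.flip v ∘ₗ d.r.flip a) (fun y e => ?_) e
    rw [hF, ← flip_comp_mulRight, ← sliceRight_lTensor, h, sliceRight_rTensor, sliceRight_T₁]
    rfl
  · intro h a v x
    refine d.ext_right fun e => ?_
    rw [sliceRight_lTensor, flip_comp_mulRight, h, sliceRight_rTensor, sliceRight_T₁]
    rfl

/-- Existence of `f(a₍₁₎, v) ⊗ a₍₂₎`, provided that it exists for the members `v` of a spanning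
set. -/
theorem isLeg_leg (hk : d.KSpans) (f : A →ₗ[K] V →ₗ[K] W)
    (hf : Submodule.span K {v : V | ∀ a, ∃ θ : W ⊗[K] A, ∀ e,
      sliceRight (d.form.flip e) θ = f (d.r e a) v} = ⊤) : H.IsLeg f (H.leg f) := by
  have hf' : ∀ v a, ∃ θ : W ⊗[K] A, ∀ e, sliceRight (d.form.flip e) θ = f (d.r e a) v := by
    intro v
    have hv : v ∈ Submodule.span K {v : V | ∀ a, ∃ θ : W ⊗[K] A, ∀ e,
      sliceRight (d.form.flip e) θ = f (d.r e a) v} := by rw [hf]; trivial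
    induction hv using Submodule.span_induction with
    | mem v hv => exact hv
    | zero => exact fun a => ⟨0, by simp⟩
    | add x y _ _ hx hy =>
      intro a
      obtain ⟨θ, hθ⟩ := hx a
      obtain ⟨θ', hθ'⟩ := hy a
      exact ⟨θ + θ', fun e => by rw [map_add, map_add, hθ, hθ']⟩
    | smul c x _ hx =>
      intro a
      obtain ⟨θ, hθ⟩ := hx a
      exact ⟨c • θ, fun e => by rw [map_smul, map_smul, hθ]⟩
  choose Θ hΘ using hf'
  refine Classical.epsilon_spec (p := H.IsLeg f) ⟨LinearMap.mk₂ K (fun a v => Θ v a)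
    (fun a a' v => d.ext_right fun e => ?_) (fun c a v => d.ext_right fun e => ?_)
    (fun a v v' => d.ext_right fun e => ?_) (fun c a v => d.ext_right fun e => ?_),
    (d.isLeg_iff hk).2 fun e a v => hΘ v a e⟩
  all_goals simp [hΘ]

/-- `Θ(a₍₁₎) ⊗ a₍₂₎ c = f(a₍₁₎) ⊗ a₍₂₎ ⊗ a₍₃₎ c` for `Θ(a) = f(a₍₁₎) ⊗ a₍₂₎`. -/
theorem rTensor_T₁ {f : A →ₗ[K] W} {Θ : A →ₗ[K] W ⊗[K] A}
    (h : ∀ e a, sliceRight (d.form.flip e) (Θ a) = f (d.r e a)) (a c : A) :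
    Θ.rTensor A (H.T₁ (a ⊗ₜ c)) = (TensorProduct.assoc K W A A).symm
      ((H.T₁.toLinearMap ∘ₗ (TensorProduct.mk K A A).flip c).lTensor W (Θ a)) := by
  have h1 : ∀ e a, Θ (d.r e a) = (d.r e).lTensor W (Θ a) := by
    intro e a
    refine d.ext_right fun x => ?_
    rw [sliceRight_lTensor, flip_comp_r, h, h, r_r]
  refine d.ext_right fun e => ?_
  rw [sliceRight_rTensor, sliceRight_T₁, h1]
  generalize Θ a = t
  induction t with
  | zero => simp
  | add x y hx hy => simp only [map_add, hx, hy]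
  | tmul w b =>
    have h2 : ∀ s : A ⊗[K] A, sliceRight (d.form.flip e)
        ((TensorProduct.assoc K W A A).symm (w ⊗ₜ s)) = w ⊗ₜ sliceRight (d.form.flip e) s := by
      intro s
      induction s with
      | zero => simp
      | tmul x y => simp
      | add x y hx hy => simp only [map_add, tmul_add, hx, hy]
    simp [h2, sliceRight_T₁]

/-! ### Cancellation of the antipode -/

/-- The pentagon equation for `T₁`: two expressions for `a₍₁₎ ⊗ a₍₂₎ x₍₁₎ ⊗ a₍₃₎ x₍₂₎ z`. -/
theorem pentagon (d : DualActions H E) (a x z : A) :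
    (H.T₁.toLinearMap ∘ₗ (TensorProduct.mk K A A).flip z).lTensor A (H.T₁ (a ⊗ₜ x)) =
      TensorProduct.lift (LinearMap.mk₂ K
        (fun u v => TensorProduct.assoc K A A A
          ((H.T₁.toLinearMap ∘ₗ (TensorProduct.mk K A A).flip u).rTensor A (H.T₁ (a ⊗ₜ v))))
        (fun u u' v => by simp [LinearMap.comp_add, LinearMap.rTensor_add])
        (fun c u v => by simp [LinearMap.comp_smul, LinearMap.rTensor_smul])
        (fun u v v' => by simp [tmul_add])
        (fun c u v => by simp)) (H.T₁ (x ⊗ₜ z)) := by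
  refine d.ext_left fun e => ?_
  rw [sliceLeft_lTensor, sliceLeft_T₁]
  simp only [LinearMap.comp_apply, LinearMap.flip_apply, mk_apply, LinearEquiv.coe_coe]
  rw [H.T₁_mul_left]
  generalize H.T₁ (x ⊗ₜ z) = t
  induction t with
  | zero => simp
  | add x y hx hy => simp only [map_add, hx, hy]
  | tmul u v =>
    rw [H.comulLeft_tmul, T₁_l, lift.tmul, LinearMap.mk₂_apply]
    generalize H.T₁ (a ⊗ₜ v) = t
    induction t with
    | zero => simp
    | add x y hx hy => simp only [map_add, hx, hy]
    | tmul p q =>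
      have h2 : ∀ s : A ⊗[K] A, sliceLeft (d.form.flip e)
          (TensorProduct.assoc K A A A (s ⊗ₜ q)) = sliceLeft (d.form.flip e) s ⊗ₜ q := by
        intro s
        induction s with
        | zero => simp
        | tmul x y => simp [smul_tmul']
        | add x y hx hy => simp only [map_add, add_tmul, hx, hy]
      simp [h2, sliceLeft_T₁]

/-- `⟨S(a₍₁₎) (a₍₂₎ x)₍₁₎, e⟩ (a₍₂₎ x)₍₂₎ = a ⟨x₍₁₎, e⟩ x₍₂₎`. Here `k' c e` represents the linear
form `⟨c ·, e⟩`. -/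
theorem l_antipode_T₁ {S : A ≃ₗ[K] A} (hS : H.IsAntipode S) (k' : A →ₗ[K] E →ₗ[K] E)
    (hk' : ∀ c a e, d.form (c * a) e = d.form a (k' c e)) (e : E) (a x : A) :
    TensorProduct.lift (d.l ∘ₗ k'.flip e ∘ₗ S.toLinearMap) (H.T₁ (a ⊗ₜ x)) = a * d.l e x := by
  obtain ⟨ε, h, hS⟩ := hS.exists_mul_eq
  refine H.eq_of_mul_eq fun z => ?_
  -- `p ⊗ q ⊗ q' ↦ ⟨S(p) q, e⟩ q'`
  let Ψ : A ⊗[K] (A ⊗[K] A) →ₗ[K] A := TensorProduct.lift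
    (LinearMap.mk₂ K (fun p t => sliceLeft (d.form.flip (k' (S p) e)) t)
      (fun p p' t => by
        rw [map_add, map_add, LinearMap.add_apply, map_add, sliceLeft_add, LinearMap.add_apply])
      (fun c p t => by
        rw [map_smul, map_smul, LinearMap.smul_apply, map_smul, sliceLeft_smul,
          LinearMap.smul_apply])
      (fun p t t' => map_add _ _ _) (fun c p t => map_smul _ _ _))
  have hΨ : ∀ p t, Ψ (p ⊗ₜ t) = sliceLeft (d.form.flip (k' (S p) e)) t := fun p t => rfl
  have hp := congrArg Ψ (d.pentagon a x z)
  have h1 : ∀ t : A ⊗[K] A, Ψ ((H.T₁.toLinearMap ∘ₗ (TensorProduct.mk K A A).flip z).lTensor A t) =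
      TensorProduct.lift (d.l ∘ₗ k'.flip e ∘ₗ S.toLinearMap) t * z := by
    intro t
    induction t with
    | zero => simp
    | tmul p q => simp [hΨ, sliceLeft_T₁]
    | add x y hx hy => simp only [map_add, add_mul, hx, hy]
  rw [h1] at hp
  rw [hp, mul_assoc, ← sliceLeft_T₁]
  generalize H.T₁ (x ⊗ₜ z) = t
  induction t with
  | zero => simp
  | add x y hx hy => simp only [map_add, mul_add, hx, hy]
  | tmul u v =>
    rw [lift.tmul, LinearMap.mk₂_apply]
    have h3 : ∀ (t : A ⊗[K] A) (q : A), Ψ (TensorProduct.assoc K A A A (t ⊗ₜ q)) =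
        d.form (H.antipodeMul ε t) e • q := by
      intro t q
      induction t with
      | zero => simp
      | tmul x y => simp [hΨ, ← hS, hk']
      | add x y hx hy => simp only [map_add, add_tmul, hx, hy, LinearMap.add_apply, add_smul]
    have h4 : ∀ t : A ⊗[K] A, Ψ (TensorProduct.assoc K A A A
        ((H.T₁.toLinearMap ∘ₗ (TensorProduct.mk K A A).flip u).rTensor A t)) =
          d.form u e • sliceLeft ε t := by
      intro t
      induction t with
      | zero => simp
      | tmul x y =>
        simp only [LinearMap.rTensor_tmul, LinearMap.comp_apply, LinearMap.flip_apply, mk_apply,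
          LinearEquiv.coe_coe]
        rw [h3, MultiplierHopfAlgebra.antipodeMul_T₁]
        simp [smul_smul, mul_comm]
      | add x y hx hy => simp only [map_add, smul_add, hx, hy]
    rw [h4, h.sliceLeft_T₁]
    simp [mul_smul_comm]

/-- `a₍₁₎ b S(a₍₂₎) a₍₃₎ c = a b c`. -/
theorem adjoint_T₁ {H : RegularMultiplierHopfAlgebra K A}
    (d : DualActions H.toMultiplierHopfAlgebra E)
    (hcop : ∀ e a x, sliceLeft (d.form.flip e) (H.cop.T₁ (a ⊗ₜ x)) = d.r e a * x) (a b c : A) :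
    TensorProduct.lift (LinearMap.mul K A ∘ₗ H.adjoint ∘ₗ (TensorProduct.mk K A A).flip b)
      (H.T₁ (a ⊗ₜ c)) = a * (b * c) := by
  obtain ⟨ε, h, hS⟩ := H.isAntipode_antipode.exists_mul_eq
  obtain ⟨ε', h'⟩ := H.cop.exists_isCounit
  obtain rfl := H.cop_isCounit_eq h h'
  let Θ : A →ₗ[K] A ⊗[K] A := (TensorProduct.comm K A A).toLinearMap ∘ₗ H.cop.T₁.toLinearMap ∘ₗ
    (TensorProduct.mk K A A).flip b
  have hΘ : ∀ x, Θ x = TensorProduct.comm K A A (H.cop.T₁ (x ⊗ₜ b)) := fun x => rfl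
  have h1 := d.rTensor_T₁ (Θ := Θ) (f := LinearMap.mulRight K b)
    (fun e a => by rw [hΘ, sliceRight_comm, hcop]; rfl) a c
  -- `(x ⊗ y) ⊗ z ↦ x S(y) z`
  let Ψ : (A ⊗[K] A) ⊗[K] A →ₗ[K] A := LinearMap.mul' K A ∘ₗ
    (LinearMap.mul' K A ∘ₗ H.antipode.toLinearMap.lTensor A).rTensor A
  have h2 : ∀ t : A ⊗[K] A, Ψ (Θ.rTensor A t) = TensorProduct.lift
      (LinearMap.mul K A ∘ₗ H.adjoint ∘ₗ (TensorProduct.mk K A A).flip b) t := by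
    intro t
    induction t with
    | zero => simp
    | add x y hx hy => simp only [map_add, hx, hy]
    | tmul p q =>
      simp only [Ψ, LinearMap.rTensor_tmul, LinearMap.comp_apply, lift.tmul, LinearMap.mul'_apply,
        LinearMap.mul_apply', RegularMultiplierHopfAlgebra.adjoint, LinearMap.flip_apply, mk_apply,
        hΘ, LinearEquiv.coe_coe]
      congr 1
      generalize H.cop.T₁ (p ⊗ₜ b) = t
      induction t with
      | zero => simp
      | tmul x y => simp
      | add x y hx hy => simp only [map_add, hx, hy]
  have h3 : ∀ t : A ⊗[K] A, Ψ ((TensorProduct.assoc K A A A).symm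
      ((H.T₁.toLinearMap ∘ₗ (TensorProduct.mk K A A).flip c).lTensor A t)) =
      sliceRight ε t * c := by
    intro t
    induction t with
    | zero => simp
    | add x y hx hy => simp only [map_add, add_mul, hx, hy]
    | tmul w u =>
      have h4 : ∀ s : A ⊗[K] A, Ψ ((TensorProduct.assoc K A A A).symm (w ⊗ₜ s)) =
          w * H.antipodeMul ε s := by
        intro s
        induction s with
        | zero => simp
        | add x y hx hy => simp only [map_add, tmul_add, mul_add, hx, hy]
        | tmul x y => simp [Ψ, ← hS, mul_assoc]
      simp [h4, MultiplierHopfAlgebra.antipodeMul_T₁, mul_smul_comm, smul_mul_assoc]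
  rw [← h2, h1, h3, hΘ, sliceRight_comm, h'.sliceLeft_T₁]
  simp [mul_assoc]

end DualActions

namespace RegularMultiplierHopfAlgebra

variable {K : Type*} [Field K] {A : Type*} [NonUnitalRing A] [Module K A]
  [IsScalarTower K A A] [SMulCommClass K A A] (H : RegularMultiplierHopfAlgebra K A)

theorem coop_antipode : H.coop.antipode = H.antipode.symm :=
  H.coop.isAntipode_antipode.unique H.cop_isAntipode_antipode_symm

theorem coop_adjoint : H.coop.adjoint = H.adjointInv := by
  rw [adjoint, coop_antipode]; rfl

theorem adjoint_surjective : Function.Surjective H.adjoint := by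
  have h : Function.Surjective (H.antipode.toLinearMap.rTensor A) :=
    LinearMap.rTensor_surjective A H.antipode.surjective
  exact H.mul'_surjective.comp
    ((TensorProduct.comm K A A).surjective.comp (h.comp H.cop.T₁.surjective))

theorem adjointInv_surjective : Function.Surjective H.adjointInv := by
  rw [← coop_adjoint]; exact H.coop.adjoint_surjective

end RegularMultiplierHopfAlgebra

/-! ### Existence of legs by covering -/

namespace DualActions

variable {K : Type*} [Field K] {A : Type*} [NonUnitalRing A] [Module K A]
  [IsScalarTower K A A] [SMulCommClass K A A] {H : MultiplierHopfAlgebra K A}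
  {E : Type*} [AddCommGroup E] [Module K E] (d : DualActions H E)
  {V W : Type*} [AddCommGroup V] [Module K V] [AddCommGroup W] [Module K W]
  {X V₀ : Type*} [AddCommGroup X] [Module K X] [AddCommGroup V₀] [Module K V₀]

/-- The form applied to the last leg of `(c ⊗ 1)Δ(a₍₁₎) ⊗ a₍₂₎ = (c ⊗ 1 ⊗ 1)(a₍₁₎ ⊗ Δ(a₍₂₎))`. -/
theorem T₂_r (hk : d.KSpans) (e : E) (c a : A) :
    H.T₂ (c ⊗ₜ d.r e a) = (d.r e).lTensor A (H.T₂ (c ⊗ₜ a)) := by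
  refine d.ext_right fun x => ?_
  rw [sliceRight_lTensor, flip_comp_r, sliceRight_T₂ d hk, sliceRight_T₂ d hk, r_r]

/-- `f(a₍₁₎, v) ⊗ a₍₂₎` exists if the vectors `v = g x v₀` span `V` and
`f(a₍₁₎, g x v₀) ⊗ a₍₂₎ = f'(T(a ⊗ x), v₀)` for some `T : A ⊗ X → A ⊗ A`, where `f'(·, v₀)` acts on
the first leg. The map `T` absorbs `x` into the coproduct of `a`. -/
theorem isLeg_leg_of_cover (hk : d.KSpans) {f : A →ₗ[K] V →ₗ[K] W} {f' : A →ₗ[K] V₀ →ₗ[K] W}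
    {g : X →ₗ[K] V₀ →ₗ[K] V} {T : A ⊗[K] X →ₗ[K] A ⊗[K] A}
    (hg : Submodule.span K {v : V | ∃ x v₀, g x v₀ = v} = ⊤)
    (hT : ∀ e a x v₀, f' (sliceRight (d.form.flip e) (T (a ⊗ₜ x))) v₀ = f (d.r e a) (g x v₀)) :
    H.IsLeg f (H.leg f) := by
  refine d.isLeg_leg hk f (top_le_iff.mp ?_)
  rw [← hg]
  refine Submodule.span_mono ?_
  rintro _ ⟨x, v₀, rfl⟩ a
  exact ⟨(f'.flip v₀).rTensor A (T (a ⊗ₜ x)), fun e => by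
    rw [sliceRight_rTensor, ← hT]; rfl⟩

theorem leg_cover (hk : d.KSpans) {f : A →ₗ[K] V →ₗ[K] W} {f' : A →ₗ[K] V₀ →ₗ[K] W}
    {g : X →ₗ[K] V₀ →ₗ[K] V} {T : A ⊗[K] X →ₗ[K] A ⊗[K] A}
    (hg : Submodule.span K {v : V | ∃ x v₀, g x v₀ = v} = ⊤)
    (hT : ∀ e a x v₀, f' (sliceRight (d.form.flip e) (T (a ⊗ₜ x))) v₀ = f (d.r e a) (g x v₀))
    (a : A) (x : X) (v₀ : V₀) :
    H.leg f a (g x v₀) = (f'.flip v₀).rTensor A (T (a ⊗ₜ x)) := by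
  refine d.ext_right fun e => ?_
  rw [sliceRight_rTensor, (d.isLeg_iff hk).1 (d.isLeg_leg_of_cover hk hg hT), ← hT]
  rfl

theorem leg_surjective (hk : d.KSpans) {f : A →ₗ[K] V →ₗ[K] W} {f' : A →ₗ[K] V₀ →ₗ[K] W}
    {g : X →ₗ[K] V₀ →ₗ[K] V} {T : A ⊗[K] X →ₗ[K] A ⊗[K] A}
    (hg : Submodule.span K {v : V | ∃ x v₀, g x v₀ = v} = ⊤)
    (hT : ∀ e a x v₀, f' (sliceRight (d.form.flip e) (T (a ⊗ₜ x))) v₀ = f (d.r e a) (g x v₀))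
    (hf' : Submodule.span K {w : W | ∃ a v₀, f' a v₀ = w} = ⊤) (hTs : Function.Surjective T) :
    Function.Surjective (TensorProduct.lift (H.leg f)) := by
  rw [← LinearMap.range_eq_top, eq_top_iff]
  have h1 : ∀ (t : A ⊗[K] A) (v₀ : V₀), (f'.flip v₀).rTensor A t ∈
      LinearMap.range (TensorProduct.lift (H.leg f)) := by
    intro t v₀
    obtain ⟨t, rfl⟩ := hTs t
    induction t with
    | zero => simp
    | add x y hx hy => rw [map_add, map_add]; exact Submodule.add_mem _ hx hy
    | tmul a x => exact ⟨a ⊗ₜ g x v₀, by rw [lift.tmul, d.leg_cover hk hg hT]⟩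
  rintro t -
  induction t with
  | zero => exact Submodule.zero_mem _
  | add x y hx hy => exact Submodule.add_mem _ hx hy
  | tmul w b =>
    have hw : w ∈ Submodule.span K {w : W | ∃ a v₀, f' a v₀ = w} := by rw [hf']; trivial
    induction hw using Submodule.span_induction with
    | mem w hw => obtain ⟨a, v₀, rfl⟩ := hw; simpa using h1 (a ⊗ₜ b) v₀
    | zero => rw [zero_tmul]; exact Submodule.zero_mem _
    | add x y _ _ hx hy => rw [add_tmul]; exact Submodule.add_mem _ hx hy
    | smul c x _ hx => rw [← smul_tmul']; exact Submodule.smul_mem _ _ hx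

end DualActions

/-! ### Pairings -/

namespace HopfPairing

variable {K : Type*} [Field K]
  {A : Type*} [NonUnitalRing A] [Module K A] [IsScalarTower K A A] [SMulCommClass K A A]
  {B : Type*} [NonUnitalRing B] [Module K B] [IsScalarTower K B B] [SMulCommClass K B B]
  {HA : RegularMultiplierHopfAlgebra K A} {HB : RegularMultiplierHopfAlgebra K B}
  (P : HopfPairing HA HB)

/-- The pairing of `B` with `A`; the roles of `lA`, `lB` and of `rA`, `rB` are exchanged. -/
noncomputable def swap : HopfPairing HB HA where
  form := P.form.flip
  nondegenerate := ⟨P.nondegenerate.2, P.nondegenerate.1⟩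
  regular_lA := P.regular_lB
  regular_rA := P.regular_rB
  regular_lB := P.regular_lA
  regular_rB := P.regular_rA
  form_mul_left b b' a := P.form_mul_right a b b'
  form_mul_left' b b' a := P.form_mul_right' a b b'
  form_mul_right b a a' := P.form_mul_left a a' b
  form_mul_right' b a a' := P.form_mul_left' a a' b

/-- The actions of `B` on `A`. -/
noncomputable def dualA : DualActions HA.toMultiplierHopfAlgebra B where
  form := P.form
  eq_zero := P.nondegenerate.1
  mu := LinearMap.mul K B
  mu_assoc e e' e'' := mul_assoc e e' e''
  l := P.rA
  r := P.lA
  k := P.lB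
  sliceLeft_T₁ e a x :=
    (MultiplierHopfAlgebra.sliceElem_mul _ P.form.flip P.regular_rA e a x).symm
  form_l e a e' := (P.form_mul_right' a e e').symm
  form_r e a e' := (P.form_mul_right a e' e).symm
  form_mul a c e := P.form_mul_left a c e

/-- The actions of `B` on `A`, from the point of view of `(A, Δᶜᵒᵖ)`. -/
noncomputable def dualCopA : DualActions HA.cop B where
  form := P.form
  eq_zero := P.nondegenerate.1
  mu := (LinearMap.mul K B).flip
  mu_assoc e e' e'' := (mul_assoc e'' e' e).symm
  l := P.lA
  r := P.rA
  k := P.lB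
  sliceLeft_T₁ e a x :=
    (MultiplierHopfAlgebra.sliceElem_mul _ P.form.flip P.regular_lA e a x).symm
  form_l e a e' := (P.form_mul_right a e' e).symm
  form_r e a e' := (P.form_mul_right' a e e').symm
  form_mul a c e := P.form_mul_left a c e

/-- The actions of `A` on `B`. -/
noncomputable def dualB : DualActions HB.toMultiplierHopfAlgebra A := P.swap.dualA

/-- The actions of `A` on `B`, from the point of view of `(B, Δᶜᵒᵖ)`. -/
noncomputable def dualCopB : DualActions HB.cop A := P.swap.dualCopA

theorem span_lA : Submodule.span K {x : A | ∃ b a, P.lA b a = x} = ⊤ := P.dualA.span_r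
theorem span_rA : Submodule.span K {x : A | ∃ b a, P.rA b a = x} = ⊤ := P.dualCopA.span_r
theorem span_lB : Submodule.span K {x : B | ∃ a b, P.lB a b = x} = ⊤ := P.dualB.span_r
theorem span_rB : Submodule.span K {x : B | ∃ a b, P.rB a b = x} = ⊤ := P.dualCopB.span_r

theorem kSpans_dualA : P.dualA.KSpans := P.span_lB
theorem kSpans_dualCopA : P.dualCopA.KSpans := P.span_lB
theorem kSpans_dualB : P.dualB.KSpans := P.span_lA
theorem kSpans_dualCopB : P.dualCopB.KSpans := P.span_lA

theorem lA_lA (b b' : B) (a : A) : P.lA b (P.lA b' a) = P.lA (b * b') a := P.dualA.r_r b b' a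
theorem rA_rA (b b' : B) (a : A) : P.rA b (P.rA b' a) = P.rA (b' * b) a := P.dualA.l_l b b' a
theorem rA_lA (b b' : B) (a : A) : P.rA b (P.lA b' a) = P.lA b' (P.rA b a) := P.dualA.l_r b b' a
theorem lB_lB (a a' : A) (b : B) : P.lB a (P.lB a' b) = P.lB (a * a') b := P.swap.lA_lA a a' b
theorem rB_rB (a a' : A) (b : B) : P.rB a (P.rB a' b) = P.rB (a' * a) b := P.swap.rA_rA a a' b
theorem rB_lB (a a' : A) (b : B) : P.rB a (P.lB a' b) = P.lB a' (P.rB a b) := P.swap.rA_lA a a' b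

theorem sliceLeft_T₁_A (b : B) (a x : A) :
    sliceLeft (P.form.flip b) (HA.T₁ (a ⊗ₜ x)) = P.rA b a * x := P.dualA.sliceLeft_T₁ b a x
theorem sliceLeft_cop_T₁_A (b : B) (a x : A) :
    sliceLeft (P.form.flip b) (HA.cop.T₁ (a ⊗ₜ x)) = P.lA b a * x := P.dualCopA.sliceLeft_T₁ b a x
theorem sliceLeft_T₁_B (a : A) (b x : B) :
    sliceLeft (P.form a) (HB.T₁ (b ⊗ₜ x)) = P.rB a b * x := P.dualB.sliceLeft_T₁ a b x
theorem sliceLeft_cop_T₁_B (a : A) (b x : B) :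
    sliceLeft (P.form a) (HB.cop.T₁ (b ⊗ₜ x)) = P.lB a b * x := P.dualCopB.sliceLeft_T₁ a b x
theorem sliceRight_cop_T₂_B (a : A) (c b : B) :
    sliceRight (P.form a) (HB.cop.T₂ (c ⊗ₜ b)) = c * P.rB a b :=
  P.dualCopB.sliceRight_T₂ P.kSpans_dualCopB a c b

theorem ext_sliceRight_A {W : Type*} [AddCommGroup W] [Module K W] {t t' : W ⊗[K] A}
    (h : ∀ b, sliceRight (P.form.flip b) t = sliceRight (P.form.flip b) t') : t = t' :=
  P.dualA.ext_right h
theorem ext_sliceLeft_A {W : Type*} [AddCommGroup W] [Module K W] {t t' : A ⊗[K] W}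
    (h : ∀ b, sliceLeft (P.form.flip b) t = sliceLeft (P.form.flip b) t') : t = t' :=
  P.dualA.ext_left h
theorem ext_sliceRight_B {W : Type*} [AddCommGroup W] [Module K W] {t t' : W ⊗[K] B}
    (h : ∀ a, sliceRight (P.form a) t = sliceRight (P.form a) t') : t = t' :=
  P.dualB.ext_right h
theorem ext_sliceLeft_B {W : Type*} [AddCommGroup W] [Module K W] {t t' : B ⊗[K] W}
    (h : ∀ a, sliceLeft (P.form a) t = sliceLeft (P.form a) t') : t = t' :=
  P.dualB.ext_left h

/-! ### The legs `b₍₁₎ ▶ a ⊗ b₍₂₎` and their slices -/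

theorem antipode_symm_mul {C : Type*} [NonUnitalRing C] [Module K C] [IsScalarTower K C C]
    [SMulCommClass K C C] (H : RegularMultiplierHopfAlgebra K C) (x y : C) :
    H.antipode.symm (x * H.antipode y) = y * H.antipode.symm x := by
  rw [LinearEquiv.symm_apply_eq, H.isAntipode_antipode.map_mul, LinearEquiv.apply_symm_apply]

/-- `b₍₁₎ c ▶ a ⊗ b₍₂₎ = b₍₁₎ ▶ (c ▶ a) ⊗ b₍₂₎`, slice by slice. -/
theorem cover_G (α : A) (b c : B) (a : A) :
    P.lA (sliceRight (P.dualB.form.flip α) (((TensorProduct.comm K B B).toLinearMap ∘ₗ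
      HB.cop.T₁.toLinearMap) (b ⊗ₜ c))) a = P.lA (P.dualB.r α b) (P.lA c a) := by
  rw [lA_lA]
  exact congrArg (P.lA · a) ((sliceRight_comm _ _).trans (P.sliceLeft_cop_T₁_B α b c))

/-- `a ◀ S⁻¹(b₍₂₎ S(c)) ⊗ b₍₁₎ = (a ◀ c) ◀ S⁻¹(b₍₂₎) ⊗ b₍₁₎`, slice by slice. -/
theorem cover_G' (α : A) (b c : B) (a : A) :
    P.rAInv (sliceRight (P.dualCopB.form.flip α) (((TensorProduct.comm K B B).toLinearMap ∘ₗ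
      HB.T₁.toLinearMap ∘ₗ HB.antipode.toLinearMap.lTensor B) (b ⊗ₜ c))) a =
      P.rAInv (P.dualCopB.r α b) (P.rA c a) := by
  refine (congrArg (P.rAInv · a)
    ((sliceRight_comm _ _).trans (P.sliceLeft_T₁_B α b (HB.antipode c)))).trans ?_
  simp only [rAInv, LinearMap.comp_apply, LinearEquiv.coe_coe]
  rw [antipode_symm_mul, rA_rA]
  rfl

/-- `b ◀ S⁻¹(a₍₁₎ S(c)) ⊗ a₍₂₎ = (b ◀ c) ◀ S⁻¹(a₍₁₎) ⊗ a₍₂₎`, slice by slice. -/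
theorem cover_F (β : B) (a c : A) (b : B) :
    P.rBInv (sliceRight (P.dualA.form.flip β) (((TensorProduct.comm K A A).toLinearMap ∘ₗ
      HA.cop.T₁.toLinearMap ∘ₗ HA.antipode.toLinearMap.lTensor A) (a ⊗ₜ c))) b =
      P.rBInv (P.dualA.r β a) (P.rB c b) := by
  refine (congrArg (P.rBInv · b)
    ((sliceRight_comm _ _).trans (P.sliceLeft_cop_T₁_A β a (HA.antipode c)))).trans ?_
  simp only [rBInv, LinearMap.comp_apply, LinearEquiv.coe_coe]
  rw [antipode_symm_mul, rB_rB]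
  rfl

/-- `G₁ (b ⊗ a) = a ◀ b₍₂₎ ⊗ b₍₁₎`, whose inverse up to flips is `G'`. -/
noncomputable def G₁ : B ⊗[K] A →ₗ[K] A ⊗[K] B := TensorProduct.lift (HB.cop.leg P.rA)

/-- `a ◀ c b₍₂₎ ⊗ b₍₁₎ = (a ◀ c) ◀ b₍₂₎ ⊗ b₍₁₎`, slice by slice. -/
theorem cover_G₁ (α : A) (b c : B) (a : A) :
    P.rA (sliceRight (P.dualCopB.form.flip α) ((HB.cop.T₂.toLinearMap ∘ₗ
      (TensorProduct.comm K B B).toLinearMap) (b ⊗ₜ c))) a =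
      P.rA (P.dualCopB.r α b) (P.rA c a) := by
  rw [rA_rA]
  exact congrArg (P.rA · a) (P.sliceRight_cop_T₂_B α c b)

/-- `J y b = b₍₁₎ ⊗ b₍₂₎ ▶ y`, which is also `y₍₂₎ ▶ b ⊗ y₍₁₎`. -/
noncomputable def J : A →ₗ[K] B →ₗ[K] B ⊗[K] A := HA.cop.leg P.lB

/-- `(a₍₂₎ c) ▶ b ⊗ a₍₁₎ = a₍₂₎ ▶ (c ▶ b) ⊗ a₍₁₎`, slice by slice. -/
theorem cover_J (β : B) (a c : A) (b : B) :
    P.lB (sliceRight (P.dualCopA.form.flip β) (((TensorProduct.comm K A A).toLinearMap ∘ₗ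
      HA.T₁.toLinearMap) (a ⊗ₜ c))) b = P.lB (P.dualCopA.r β a) (P.lB c b) := by
  rw [lB_lB]
  exact congrArg (P.lB · b) ((sliceRight_comm _ _).trans (P.sliceLeft_T₁_A β a c))

theorem isLeg_G : HB.IsLeg P.lA (HB.leg P.lA) :=
  P.dualB.isLeg_leg_of_cover P.kSpans_dualB P.span_lA P.cover_G
theorem isLeg_G' : HB.cop.IsLeg P.rAInv (HB.cop.leg P.rAInv) :=
  P.dualCopB.isLeg_leg_of_cover P.kSpans_dualCopB P.span_rA P.cover_G'
theorem isLeg_F : HA.IsLeg P.rBInv (HA.leg P.rBInv) :=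
  P.dualA.isLeg_leg_of_cover P.kSpans_dualA P.span_rB P.cover_F
theorem isLeg_G₁ : HB.cop.IsLeg P.rA (HB.cop.leg P.rA) :=
  P.dualCopB.isLeg_leg_of_cover P.kSpans_dualCopB P.span_rA P.cover_G₁
theorem isLeg_J : HA.cop.IsLeg P.lB (HA.cop.leg P.lB) :=
  P.dualCopA.isLeg_leg_of_cover P.kSpans_dualCopA P.span_lB P.cover_J

theorem wellDefined : P.WellDefined where
  antipode_A := HA.isAntipode_antipode
  antipode_B := HB.isAntipode_antipode
  leg_G := P.isLeg_G
  leg_G' := P.isLeg_G'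
  leg_F := P.isLeg_F

theorem sliceRight_G (α : A) (b : B) (a : A) :
    sliceRight (P.form α) (P.G (b ⊗ₜ a)) = P.lA (P.lB α b) a :=
  (P.dualB.isLeg_iff P.kSpans_dualB).1 P.isLeg_G α b a
theorem sliceRight_G' (α : A) (b : B) (a : A) :
    sliceRight (P.form α) (P.G' (b ⊗ₜ a)) = P.rAInv (P.rB α b) a :=
  (P.dualCopB.isLeg_iff P.kSpans_dualCopB).1 P.isLeg_G' α b a
theorem sliceRight_F (β : B) (a : A) (b : B) :
    sliceRight (P.form.flip β) (P.F (a ⊗ₜ b)) = P.rBInv (P.lA β a) b :=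
  (P.dualA.isLeg_iff P.kSpans_dualA).1 P.isLeg_F β a b
theorem sliceRight_G₁ (α : A) (b : B) (a : A) :
    sliceRight (P.form α) (P.G₁ (b ⊗ₜ a)) = P.rA (P.rB α b) a :=
  (P.dualCopB.isLeg_iff P.kSpans_dualCopB).1 P.isLeg_G₁ α b a
theorem sliceRight_J (β : B) (y : A) (b : B) :
    sliceRight (P.form.flip β) (P.J y b) = P.lB (P.rA β y) b :=
  (P.dualCopA.isLeg_iff P.kSpans_dualCopA).1 P.isLeg_J β y b

/-- `G (b ⊗ (c ▶ a)) = b₍₁₎ c ▶ a ⊗ b₍₂₎`. -/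
theorem G_lA (b c : B) (a : A) : P.G (b ⊗ₜ P.lA c a) =
    (P.lA.flip a).rTensor B (TensorProduct.comm K B B (HB.cop.T₁ (b ⊗ₜ c))) :=
  P.dualB.leg_cover P.kSpans_dualB P.span_lA P.cover_G b c a

/-- `G₁ (b ⊗ (a ◀ c)) = a ◀ c b₍₂₎ ⊗ b₍₁₎`. -/
theorem G₁_rA (b c : B) (a : A) : P.G₁ (b ⊗ₜ P.rA c a) =
    (P.rA.flip a).rTensor B (HB.cop.T₂ (c ⊗ₜ b)) :=
  P.dualCopB.leg_cover P.kSpans_dualCopB P.span_rA P.cover_G₁ b c a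

theorem G_surjective : Function.Surjective P.G :=
  P.dualB.leg_surjective P.kSpans_dualB P.span_lA P.cover_G P.span_lA
    ((TensorProduct.comm K B B).surjective.comp HB.cop.T₁.surjective)

theorem F_surjective : Function.Surjective P.F := by
  have h : Function.Surjective (HA.antipode.toLinearMap.lTensor A) :=
    LinearMap.lTensor_surjective A HA.antipode.surjective
  refine P.dualA.leg_surjective P.kSpans_dualA P.span_rB P.cover_F (top_le_iff.mp ?_)
    ((TensorProduct.comm K A A).surjective.comp (HA.cop.T₁.surjective.comp h))
  rw [← P.span_rB]
  refine Submodule.span_mono ?_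
  rintro _ ⟨a, b, rfl⟩
  exact ⟨HA.antipode a, b, by simp [rBInv]⟩

theorem G₁_surjective : Function.Surjective P.G₁ :=
  P.dualCopB.leg_surjective P.kSpans_dualCopB P.span_rA P.cover_G₁ P.span_rA
    (HB.cop.T₂.surjective.comp (TensorProduct.comm K B B).surjective)

theorem J_surjective : Function.Surjective (TensorProduct.lift P.J) :=
  P.dualCopA.leg_surjective P.kSpans_dualCopA P.span_lB P.cover_J P.span_lB
    ((TensorProduct.comm K A A).surjective.comp HA.T₁.surjective)

/-- The first leg of `J y b = b₍₁₎ ⊗ b₍₂₎ ▶ y` is that of the coproduct of `b`, although `J` is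
defined by means of the coproduct of `y`. -/
theorem sliceLeft_J (α : A) (y : A) (b : B) :
    sliceLeft (P.form α) (P.J y b) = P.lA (P.rB α b) y := by
  refine P.dualA.ext_form fun β => ?_
  refine (apply_sliceLeft (P.form α) (P.form.flip β) (P.J y b)).trans ?_
  rw [sliceRight_J]
  change P.form α (P.lB (P.rA β y) b) = P.form (P.lA (P.rB α b) y) β
  rw [← P.form_mul_left, ← P.form_mul_right, P.form_mul_right', P.form_mul_left']

end HopfPairing

/-! ### The representation of the Heisenberg double on `A` -/

namespace HopfPairing

variable {K : Type*} [Field K]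
  {A : Type*} [NonUnitalRing A] [Module K A] [IsScalarTower K A A] [SMulCommClass K A A]
  {B : Type*} [NonUnitalRing B] [Module K B] [IsScalarTower K B B] [SMulCommClass K B B]
  {HA : RegularMultiplierHopfAlgebra K A} {HB : RegularMultiplierHopfAlgebra K B}
  (P : HopfPairing HA HB)

/-- The representation of the Heisenberg double `A # B` on `A`,
`a # b ↦ (x ↦ a (b ▶ x))`. -/
noncomputable def rep : A ⊗[K] B →ₗ[K] A →ₗ[K] A :=
  TensorProduct.lift ((LinearMap.llcomp K A A A ∘ₗ LinearMap.mul K A).compl₂ P.lA)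

@[simp] theorem rep_tmul (a : A) (b : B) (x : A) : P.rep (a ⊗ₜ b) x = a * P.lA b x := rfl

/-- `q ⊗ p ↦ ∑ aᵢ ⟨q, bᵢ⟩ p` for `t = ∑ aᵢ ⊗ bᵢ`. -/
noncomputable def contract (t : A ⊗[K] B) : A ⊗[K] A →ₗ[K] A :=
  TensorProduct.lift (LinearMap.mul K A ∘ₗ
    { toFun := fun q => sliceRight (P.form q) t
      map_add' := fun q q' => by rw [map_add, sliceRight_add, LinearMap.add_apply]
      map_smul' := fun c q => by rw [map_smul, sliceRight_smul]; rfl })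

theorem contract_tmul (t : A ⊗[K] B) (q p : A) :
    P.contract t (q ⊗ₜ p) = sliceRight (P.form q) t * p := rfl

/-- The formula `a (b ▶ x) z = a ⟨x₍₂₎, b⟩ x₍₁₎ z`, where `x₍₂₎ ⊗ x₍₁₎ z` lies in `A ⊗ A`. As these
tensors span `A ⊗ A`, it implies that `rep` is injective. -/
theorem contract_cop_T₁ (t : A ⊗[K] B) (x z : A) :
    P.contract t (HA.cop.T₁ (x ⊗ₜ z)) = P.rep t x * z := by
  induction t with
  | zero =>
    have : P.contract 0 = 0 := by ext q p; simp [contract_tmul]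
    simp [this]
  | add t t' ht ht' =>
    have : P.contract (t + t') = P.contract t + P.contract t' := by
      ext q p; simp [contract_tmul, add_mul]
    simp [this, ht, ht', add_mul]
  | tmul a b =>
    rw [rep_tmul, mul_assoc, ← sliceLeft_cop_T₁_A]
    generalize HA.cop.T₁ (x ⊗ₜ z) = s
    induction s with
    | zero => simp
    | add x y hx hy => simp only [map_add, mul_add, hx, hy]
    | tmul q p => simp [contract_tmul, smul_mul_assoc, mul_smul_comm]

/-- The representation of the Heisenberg double on `A` is faithful. -/
theorem rep_injective : Function.Injective P.rep := by
  rw [← LinearMap.ker_eq_bot, LinearMap.ker_eq_bot']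
  intro t ht
  refine P.ext_sliceRight_B fun q => ?_
  rw [map_zero]
  refine HA.nondegenerate.1 _ fun p => ?_
  have h : ∀ s, P.contract t (HA.cop.T₁ s) = 0 := by
    intro s
    induction s with
    | zero => simp
    | add x y hx hy => rw [map_add, map_add, hx, hy, add_zero]
    | tmul x z => rw [contract_cop_T₁, ht]; simp
  rw [← contract_tmul, ← HA.cop.T₁.apply_symm_apply (q ⊗ₜ p), h]

/-- `A` is a module algebra: `(b₍₁₎ ▶ a)(b₍₂₎ ▶ y) = b ▶ (a y)`. -/
theorem rep_G (b : B) (a y : A) : P.rep (P.G (b ⊗ₜ a)) y = P.lA b (a * y) := by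
  refine HA.eq_of_mul_eq fun z => ?_
  rw [← contract_cop_T₁, ← sliceLeft_cop_T₁_A, HA.cop.T₁_mul_left]
  generalize HA.cop.T₁ (y ⊗ₜ z) = s
  induction s with
  | zero => simp
  | add x y hx hy => simp only [map_add, hx, hy]
  | tmul q p =>
    rw [contract_tmul, sliceRight_G, MultiplierHopfAlgebra.comulLeft_tmul, sliceLeft_rTensor,
      ← sliceLeft_cop_T₁_A]
    congr 2
    ext x
    simp [P.form_mul_left]

/-- `b₍₁₎ b' S(b₍₂₎) b₍₃₎ c = b b' c`. -/
theorem T₁_adjoint_B (P : HopfPairing HA HB) (b b' c : B) :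
    TensorProduct.lift (LinearMap.mul K B ∘ₗ HB.adjoint ∘ₗ (TensorProduct.mk K B B).flip b')
      (HB.T₁ (b ⊗ₜ c)) = b * (b' * c) :=
  P.dualB.adjoint_T₁ P.sliceLeft_cop_T₁_B b b' c

/-- `a₍₃₎ a' S⁻¹(a₍₂₎) a₍₁₎ c = a a' c`. -/
theorem cop_T₁_adjointInv_A (P : HopfPairing HA HB) (a a' c : A) :
    TensorProduct.lift (LinearMap.mul K A ∘ₗ HA.adjointInv ∘ₗ (TensorProduct.mk K A A).flip a')
      (HA.cop.T₁ (a ⊗ₜ c)) = a * (a' * c) := by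
  rw [← HA.coop_adjoint]
  exact DualActions.adjoint_T₁ (H := HA.coop) P.dualCopA P.sliceLeft_T₁_A a a' c

/-! ### The actions of `A` and `B` on the Heisenberg double -/

/-- The action of `B ⊆ 𝒟`, `b · (a' # b') = b₍₁₎ ▶ a' # b₍₂₎ b' S(b₍₃₎)`. -/
noncomputable def actionB : B →ₗ[K] A ⊗[K] B →ₗ[K] A ⊗[K] B :=
  TensorProduct.curry (HB.adjoint.lTensor A ∘ₗ (TensorProduct.assoc K A B B).toLinearMap ∘ₗ
    P.G.rTensor B ∘ₗ (TensorProduct.assoc K B A B).symm.toLinearMap)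

/-- The action of `A ⊆ 𝒟`, `a · (a' # b') = a₍₃₎ a' S⁻¹(a₍₂₎) # b' ◀ S⁻¹(a₍₁₎)`. -/
noncomputable def actionA : A →ₗ[K] A ⊗[K] B →ₗ[K] A ⊗[K] B :=
  TensorProduct.curry ((TensorProduct.comm K B A).toLinearMap ∘ₗ HA.adjointInv.lTensor B ∘ₗ
    (TensorProduct.assoc K B A A).toLinearMap ∘ₗ P.F.rTensor A ∘ₗ
    (TensorProduct.assoc K A B A).symm.toLinearMap ∘ₗ
    (TensorProduct.comm K A B).toLinearMap.lTensor A)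

theorem actionB_tmul (b : B) (a' : A) (b' : B) : P.actionB b (a' ⊗ₜ b') =
    (HB.adjoint ∘ₗ (TensorProduct.mk K B B).flip b').lTensor A (P.G (b ⊗ₜ a')) := by
  simp only [actionB, curry_apply, LinearMap.comp_apply, LinearEquiv.coe_coe, assoc_symm_tmul,
    LinearMap.rTensor_tmul]
  generalize P.G (b ⊗ₜ a') = t
  induction t with
  | zero => simp
  | add x y hx hy => simp only [map_add, add_tmul, hx, hy]
  | tmul x y => simp

theorem actionA_tmul (a a' : A) (b' : B) : P.actionA a (a' ⊗ₜ b') = TensorProduct.comm K B A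
    ((HA.adjointInv ∘ₗ (TensorProduct.mk K A A).flip a').lTensor B (P.F (a ⊗ₜ b'))) := by
  simp only [actionA, curry_apply, LinearMap.comp_apply, LinearEquiv.coe_coe, assoc_symm_tmul,
    LinearMap.rTensor_tmul, LinearMap.lTensor_tmul, comm_tmul]
  generalize P.F (a ⊗ₜ b') = t
  induction t with
  | zero => simp
  | add x y hx hy => simp only [map_add, add_tmul, hx, hy]
  | tmul x y => simp

theorem action_tmul (a : A) (b : B) (h : A ⊗[K] B) :
    P.action (a ⊗ₜ b) h = P.actionA a (P.actionB b h) := by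
  induction h with
  | zero => simp
  | add x y hx hy => simp only [map_add, hx, hy]
  | tmul a' b' =>
    rw [actionB_tmul]
    simp only [action, curry_apply, LinearMap.comp_apply, LinearEquiv.coe_coe,
      tensorTensorTensorAssoc_tmul, LinearMap.rTensor_tmul, LinearMap.lTensor_tmul]
    generalize P.G (b ⊗ₜ a') = t
    induction t with
    | zero => simp
    | add x y hx hy => simp only [map_add, tmul_add, add_tmul, hx, hy]
    | tmul x y =>
      simp only [tensorTensorTensorAssoc_symm_tmul, LinearMap.lTensor_tmul, LinearMap.rTensor_tmul,
        LinearEquiv.coe_coe, comm_tmul, LinearMap.comp_apply, LinearMap.flip_apply, mk_apply,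
        actA, assoc_tmul]
      rw [actionA_tmul]
      generalize P.F (a ⊗ₜ HB.adjoint (y ⊗ₜ b')) = s
      induction s with
      | zero => simp
      | add x y hx hy => simp only [map_add, add_tmul, hx, hy]
      | tmul u v => simp

/-- In the Heisenberg double, `b h = (b₍₁₎ · h) b₍₂₎` for `b ∈ B`. -/
theorem rep_actionB_T₁ (h : A ⊗[K] B) (x : A) (b c : B) :
    TensorProduct.lift (LinearMap.compl₂ (P.rep ∘ₗ P.actionB.flip h) (P.lA.flip x))
      (HB.T₁ (b ⊗ₜ c)) = P.lA b (P.rep h (P.lA c x)) := by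
  induction h with
  | zero =>
    have : TensorProduct.lift (LinearMap.compl₂ (P.rep ∘ₗ P.actionB.flip 0) (P.lA.flip x)) = 0 :=
      TensorProduct.ext' fun p q => by simp
    rw [this]; simp
  | add u v hu hv =>
    have : TensorProduct.lift (LinearMap.compl₂ (P.rep ∘ₗ P.actionB.flip (u + v)) (P.lA.flip x)) =
        TensorProduct.lift (LinearMap.compl₂ (P.rep ∘ₗ P.actionB.flip u) (P.lA.flip x)) +
        TensorProduct.lift (LinearMap.compl₂ (P.rep ∘ₗ P.actionB.flip v) (P.lA.flip x)) :=
      TensorProduct.ext' fun p q => by simp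
    rw [this, LinearMap.add_apply, hu, hv, map_add, LinearMap.add_apply, map_add]
  | tmul a' b' =>
    -- `(a ⊗ b) ⊗ q ↦ a ((b₍₁₎ b' S(b₍₂₎) q) ▶ x)`
    let Ψ : (A ⊗[K] B) ⊗[K] B →ₗ[K] A := TensorProduct.lift (LinearMap.compl₂
      (P.rep ∘ₗ (HB.adjoint ∘ₗ (TensorProduct.mk K B B).flip b').lTensor A) (P.lA.flip x))
    let Θ : B →ₗ[K] A ⊗[K] B := P.G ∘ₗ (TensorProduct.mk K B A).flip a'
    have h1 : ∀ t : B ⊗[K] B, TensorProduct.lift (LinearMap.compl₂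
        (P.rep ∘ₗ P.actionB.flip (a' ⊗ₜ b')) (P.lA.flip x)) t = Ψ (Θ.rTensor B t) := by
      intro t
      induction t with
      | zero => simp
      | add x y hx hy => simp only [map_add, hx, hy]
      | tmul p q => simp [Ψ, Θ, actionB_tmul]
    have h2 : ∀ t : A ⊗[K] B, Ψ ((TensorProduct.assoc K A B B).symm
        ((HB.T₁.toLinearMap ∘ₗ (TensorProduct.mk K B B).flip c).lTensor A t)) =
        P.rep t (P.lA (b' * c) x) := by
      intro t
      induction t with
      | zero => simp
      | add x y hx hy => simp only [map_add, hx, hy, LinearMap.add_apply]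
      | tmul w u =>
        have h3 : ∀ s : B ⊗[K] B, Ψ ((TensorProduct.assoc K A B B).symm (w ⊗ₜ s)) =
            w * P.lA (TensorProduct.lift (LinearMap.mul K B ∘ₗ HB.adjoint ∘ₗ
              (TensorProduct.mk K B B).flip b') s) x := by
          intro s
          induction s with
          | zero => simp
          | add x y hx hy => simp only [map_add, tmul_add, mul_add, hx, hy, LinearMap.add_apply]
          | tmul p q => simp [Ψ, lA_lA]
        simp only [LinearMap.lTensor_tmul, LinearMap.comp_apply, LinearMap.flip_apply, mk_apply,
          LinearEquiv.coe_coe]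
        rw [h3, P.T₁_adjoint_B, ← lA_lA, rep_tmul]
    rw [h1, P.dualB.rTensor_T₁ (f := P.lA.flip a') (fun α b => P.sliceRight_G α b a'), h2]
    simp only [Θ, LinearMap.comp_apply, LinearMap.flip_apply, mk_apply]
    rw [rep_G, rep_tmul, lA_lA]

/-- `a₍₃₎ ⊗ (b ◀ S⁻¹(a₍₂₎)) ▶ (a₍₁₎ x) = a₍₂₎ ⊗ a₍₁₎ (b ▶ x)`. -/
theorem F_cop_T₁ (a x : A) (b : B) :
    TensorProduct.lift (LinearMap.mk₂ K (fun p q => TensorProduct.comm K A A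
      ((P.lA.flip q).rTensor A (P.F (p ⊗ₜ b))))
      (fun p p' q => by simp [add_tmul])
      (fun c p q => by rw [← smul_tmul', map_smul, map_smul, map_smul])
      (fun p q q' => by simp [LinearMap.rTensor_add])
      (fun c p q => by simp [LinearMap.rTensor_smul])) (HA.cop.T₁ (a ⊗ₜ x)) =
    HA.cop.T₁ (a ⊗ₜ P.lA b x) := by
  refine P.ext_sliceLeft_A fun β => ?_
  rw [sliceLeft_cop_T₁_A]
  refine Eq.trans ?_ (P.dualCopA.l_antipode_T₁ HA.cop_isAntipode_antipode_symm P.rB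
    (fun c a e => P.form_mul_left' c a e) b (P.lA β a) x)
  have := P.dualCopA.T₁_l β a x
  change HA.cop.T₁ (P.lA β a ⊗ₜ x) = (P.lA β).rTensor A _ at this
  rw [this]
  generalize HA.cop.T₁ (a ⊗ₜ x) = t
  induction t with
  | zero => simp
  | add x y hx hy => simp only [map_add, hx, hy]
  | tmul p q =>
    rw [lift.tmul, LinearMap.mk₂_apply, sliceLeft_comm, sliceRight_rTensor, sliceRight_F]
    rfl

/-- In the Heisenberg double, `a h = (a₍₂₎ · h) a₍₁₎` for `a ∈ A`. -/
theorem rep_actionA_T₁ (h : A ⊗[K] B) (a x : A) :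
    TensorProduct.lift (P.rep ∘ₗ P.actionA.flip h) (HA.cop.T₁ (a ⊗ₜ x)) = a * P.rep h x := by
  induction h with
  | zero =>
    have : TensorProduct.lift (P.rep ∘ₗ P.actionA.flip 0) = 0 :=
      TensorProduct.ext' fun p q => by simp
    rw [this]; simp
  | add u v hu hv =>
    have : TensorProduct.lift (P.rep ∘ₗ P.actionA.flip (u + v)) =
        TensorProduct.lift (P.rep ∘ₗ P.actionA.flip u) +
        TensorProduct.lift (P.rep ∘ₗ P.actionA.flip v) :=
      TensorProduct.ext' fun p q => by simp
    rw [this, LinearMap.add_apply, hu, hv, map_add, LinearMap.add_apply, mul_add]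
  | tmul a' b' =>
    rw [rep_tmul, ← P.cop_T₁_adjointInv_A, ← F_cop_T₁]
    generalize HA.cop.T₁ (a ⊗ₜ x) = t
    induction t with
    | zero => simp
    | add x y hx hy => simp only [map_add, hx, hy]
    | tmul p q =>
      rw [lift.tmul, lift.tmul, LinearMap.comp_apply, LinearMap.flip_apply, actionA_tmul,
        LinearMap.mk₂_apply]
      generalize P.F (p ⊗ₜ b') = s
      induction s with
      | zero => simp
      | add x y hx hy => simp only [map_add, hx, hy, LinearMap.add_apply]
      | tmul u v => simp

theorem actionB_surjective : Function.Surjective (TensorProduct.lift P.actionB) := by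
  have h1 : Function.Surjective (HB.adjoint.lTensor A) :=
    LinearMap.lTensor_surjective A HB.adjoint_surjective
  have h2 : Function.Surjective (P.G.rTensor B) := LinearMap.rTensor_surjective B P.G_surjective
  have h3 : TensorProduct.lift P.actionB = HB.adjoint.lTensor A ∘ₗ
      (TensorProduct.assoc K A B B).toLinearMap ∘ₗ P.G.rTensor B ∘ₗ
        (TensorProduct.assoc K B A B).symm.toLinearMap :=
    TensorProduct.ext' fun _ _ => rfl
  rw [h3]
  exact h1.comp ((TensorProduct.assoc K A B B).surjective.comp
    (h2.comp (TensorProduct.assoc K B A B).symm.surjective))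

theorem actionA_surjective : Function.Surjective (TensorProduct.lift P.actionA) := by
  have h1 : Function.Surjective (HA.adjointInv.lTensor B) :=
    LinearMap.lTensor_surjective B HA.adjointInv_surjective
  have h2 : Function.Surjective (P.F.rTensor A) := LinearMap.rTensor_surjective A P.F_surjective
  have h3 : Function.Surjective ((TensorProduct.comm K A B).toLinearMap.lTensor A) :=
    LinearMap.lTensor_surjective A (TensorProduct.comm K A B).surjective
  have h4 : TensorProduct.lift P.actionA = (TensorProduct.comm K B A).toLinearMap ∘ₗ
      HA.adjointInv.lTensor B ∘ₗ (TensorProduct.assoc K B A A).toLinearMap ∘ₗ P.F.rTensor A ∘ₗ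
      (TensorProduct.assoc K A B A).symm.toLinearMap ∘ₗ
      (TensorProduct.comm K A B).toLinearMap.lTensor A :=
    TensorProduct.ext' fun _ _ => rfl
  rw [h4]
  exact (TensorProduct.comm K B A).surjective.comp (h1.comp
    ((TensorProduct.assoc K B A A).surjective.comp (h2.comp
      ((TensorProduct.assoc K A B A).symm.surjective.comp h3))))

end HopfPairing

/-- A linear map `ad : C → End X` is multiplicative as soon as there are a module `V` of `C` with
`C V = V` and an injective map `π : X → End V` such that `c π(x) = π(ad(c₍₁₎) x) c₍₂₎`. -/
theorem MultiplierHopfAlgebra.map_mul_of_adjoint {K : Type*} [Field K]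
    {C : Type*} [NonUnitalRing C] [Module K C] [IsScalarTower K C C] [SMulCommClass K C C]
    (H : MultiplierHopfAlgebra K C) {V X : Type*} [AddCommGroup V] [Module K V]
    [AddCommGroup X] [Module K X] (τ : C →ₗ[K] V →ₗ[K] V) (π : X →ₗ[K] V →ₗ[K] V)
    (ad : C →ₗ[K] X →ₗ[K] X) (hτ : ∀ c c' v, τ c (τ c' v) = τ (c * c') v)
    (hspan : Submodule.span K {v : V | ∃ c w, τ c w = v} = ⊤) (hπ : Function.Injective π)
    (h : ∀ x v b c, TensorProduct.lift (LinearMap.compl₂ (π ∘ₗ ad.flip x) (τ.flip v))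
      (H.T₁ (b ⊗ₜ c)) = τ b (π x (τ c v))) (p p' : C) (x : X) :
    ad (p * p') x = ad p (ad p' x) := by
  have h1 : ∀ x v b t, τ b (TensorProduct.lift (LinearMap.compl₂ (π ∘ₗ ad.flip x) (τ.flip v)) t) =
      TensorProduct.lift (LinearMap.compl₂ (π ∘ₗ ad.flip x) (τ.flip v)) (H.comulLeft b t) := by
    intro x v b t
    obtain ⟨t, rfl⟩ := H.T₁.surjective t
    induction t with
    | zero => simp
    | add x y hx hy => simp only [map_add, hx, hy]
    | tmul b' c' => rw [← H.T₁_mul_left, h, h, hτ]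
  have h2 : ∀ v t, TensorProduct.lift (LinearMap.compl₂ (π ∘ₗ ad.flip (ad p' x)) (τ.flip v)) t =
      TensorProduct.lift (LinearMap.compl₂ (π ∘ₗ ad.flip x) (τ.flip v))
        ((LinearMap.mulRight K p').rTensor C t) := by
    intro v t
    obtain ⟨t, rfl⟩ := H.T₁.surjective t
    induction t with
    | zero => simp
    | add x y hx hy => simp only [map_add, hx, hy]
    | tmul b c => rw [h, ← H.comulLeft_tmul, ← h1]; simp
  refine hπ (LinearMap.ext_on hspan ?_)
  rintro _ ⟨q, v, rfl⟩
  simpa using (h2 v (p ⊗ₜ q)).symm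

namespace HopfPairing

variable {K : Type*} [Field K]
  {A : Type*} [NonUnitalRing A] [Module K A] [IsScalarTower K A A] [SMulCommClass K A A]
  {B : Type*} [NonUnitalRing B] [Module K B] [IsScalarTower K B B] [SMulCommClass K B B]
  {HA : RegularMultiplierHopfAlgebra K A} {HB : RegularMultiplierHopfAlgebra K B}
  (P : HopfPairing HA HB)

theorem actionB_mul (b b' : B) (h : A ⊗[K] B) :
    P.actionB (b * b') h = P.actionB b (P.actionB b' h) :=
  HB.map_mul_of_adjoint P.lA P.rep P.actionB P.lA_lA P.span_lA P.rep_injective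
    P.rep_actionB_T₁ b b' h

theorem actionA_mul (a a' : A) (h : A ⊗[K] B) :
    P.actionA (a * a') h = P.actionA a (P.actionA a' h) := by
  refine HA.cop.map_mul_of_adjoint (LinearMap.mul K A) P.rep P.actionA
    (fun a b c => (mul_assoc a b c).symm) (top_le_iff.mp ?_) P.rep_injective (fun h v b c => ?_)
    a a' h
  · rintro x -
    obtain ⟨t, rfl⟩ := HA.mul'_surjective x
    induction t with
    | zero => simp
    | add x y hx hy => rw [map_add]; exact Submodule.add_mem _ hx hy
    | tmul x y => exact Submodule.subset_span ⟨x, y, rfl⟩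
  · have := P.rep_actionA_T₁ h b (c * v)
    rw [HA.cop.T₁_mul_right] at this
    rw [LinearMap.mul_apply', LinearMap.mul_apply', ← this]
    generalize HA.cop.T₁ (b ⊗ₜ c) = t
    induction t with
    | zero => simp
    | add x y hx hy => simp only [map_add, hx, hy]
    | tmul x y => simp

end HopfPairing

/-! ### The commutation relation of the two actions -/

namespace HopfPairing

/-- `b ⊗ (p ⊗ q) ↦ f(b ⊗ p) ⊗ q`. -/
noncomputable def onPair {K A B : Type*} [Field K] [AddCommGroup A] [Module K A] [AddCommGroup B]
    [Module K B] (f : B ⊗[K] A →ₗ[K] A ⊗[K] B) :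
    B ⊗[K] (A ⊗[K] A) →ₗ[K] A ⊗[K] (B ⊗[K] A) :=
  (TensorProduct.assoc K A B A).toLinearMap ∘ₗ f.rTensor A ∘ₗ
    (TensorProduct.assoc K B A A).symm.toLinearMap

theorem onPair_tmul {K A B : Type*} [Field K] [AddCommGroup A] [Module K A] [AddCommGroup B]
    [Module K B] (f : B ⊗[K] A →ₗ[K] A ⊗[K] B) (b : B) (p q : A) :
    onPair f (b ⊗ₜ (p ⊗ₜ q)) = TensorProduct.assoc K A B A (f (b ⊗ₜ p) ⊗ₜ q) := by
  simp [onPair]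

variable {K : Type*} [Field K]
  {A : Type*} [NonUnitalRing A] [Module K A] [IsScalarTower K A A] [SMulCommClass K A A]
  {B : Type*} [NonUnitalRing B] [Module K B] [IsScalarTower K B B] [SMulCommClass K B B]
  {HA : RegularMultiplierHopfAlgebra K A} {HB : RegularMultiplierHopfAlgebra K B}
  (P : HopfPairing HA HB)

/-- `b₍₁₎ ⊗ b₍₂₎ ▶ (c ▶ x) = b₍₁₎ ⊗ b₍₂₎ c ▶ x`. -/
theorem J_lA (b c : B) (x : A) :
    P.J (P.lA c x) b = (P.lA.flip x).lTensor B (HB.T₁ (b ⊗ₜ c)) := by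
  refine P.ext_sliceRight_A fun β => ?_
  have h : P.form.flip β ∘ₗ P.lA.flip x = P.form (P.rA β x) := by
    ext q
    simp [← P.form_mul_right, ← P.form_mul_right']
  rw [sliceRight_J, sliceRight_lTensor, h, rA_lA]
  exact (P.dualB.sliceRight_T₁ (P.rA β x) b c).symm

/-- In the Heisenberg double, `b h y = (b₍₁₎ · h) (b₍₂₎ ▶ y)` for `b ∈ B` and `y ∈ A`. -/
theorem rep_actionB_J (h : A ⊗[K] B) (b : B) (y : A) :
    TensorProduct.lift (P.rep ∘ₗ P.actionB.flip h) (P.J y b) = P.lA b (P.rep h y) := by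
  refine P.dualA.eq_of_r (f := TensorProduct.lift (P.rep ∘ₗ P.actionB.flip h) ∘ₗ P.J.flip b)
    (g := P.lA b ∘ₗ P.rep h) (fun c x => ?_) y
  change TensorProduct.lift (P.rep ∘ₗ P.actionB.flip h) (P.J (P.lA c x) b) =
    P.lA b (P.rep h (P.lA c x))
  rw [J_lA, ← rep_actionB_T₁]
  generalize HB.T₁ (b ⊗ₜ c) = t
  induction t with
  | zero => simp
  | add x y hx hy => simp only [map_add, hx, hy]
  | tmul x y => simp

/-- Expressions for `b₍₁₎ ▶ a ⊗ b₍₂₎ ▶ y` in terms of `J` and of `G`. -/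
theorem rTensor_J (a y : A) (b : B) :
    (P.lA.flip a).rTensor A (P.J y b) = (P.lA.flip y).lTensor A (P.G (b ⊗ₜ a)) := by
  refine P.ext_sliceRight_A fun β => ?_
  have h : P.form.flip β ∘ₗ P.lA.flip y = P.form (P.rA β y) := by
    ext q
    simp [← P.form_mul_right, ← P.form_mul_right']
  rw [sliceRight_rTensor, sliceRight_lTensor, sliceRight_J, h, sliceRight_G]
  rfl

/-- `(b₍₁₎ ▶ a)(b₍₂₎ ▶ y) = b ▶ (a y)`. -/
theorem mul_J (a y : A) (b : B) :
    TensorProduct.lift (LinearMap.mul K A ∘ₗ P.lA.flip a) (P.J y b) = P.lA b (a * y) := by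
  rw [← rep_G]
  have h1 : ∀ t : B ⊗[K] A, TensorProduct.lift (LinearMap.mul K A ∘ₗ P.lA.flip a) t =
      LinearMap.mul' K A ((P.lA.flip a).rTensor A t) := by
    intro t
    induction t with
    | zero => simp
    | add x y hx hy => simp only [map_add, hx, hy]
    | tmul x y => simp
  rw [h1, rTensor_J]
  generalize P.G (b ⊗ₜ a) = t
  induction t with
  | zero => simp
  | add x y hx hy => simp only [map_add, hx, hy, LinearMap.add_apply]
  | tmul x y => simp

theorem J_rB (α y : A) (b : B) : P.J y (P.rB α b) = (P.rB α).rTensor A (P.J y b) := by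
  refine P.ext_sliceRight_A fun β => ?_
  rw [sliceRight_rTensor, sliceRight_J, sliceRight_J, rB_lB]

/-- Expressions for `b₍₁₎ ▶ a ⊗ b₍₂₎ ⊗ b₍₃₎ ▶ y`, with `α` applied to the middle leg, in terms of `G`
and of `J`. -/
theorem lTensor_G_eq_rTensor_J (α a y : A) (b : B) :
    (P.lA.flip y ∘ₗ P.rB α).lTensor A (P.G (b ⊗ₜ a)) =
      (P.lA.flip a ∘ₗ P.lB α).rTensor A (P.J y b) := by
  refine P.ext_sliceRight_A fun β => ?_
  have h : P.form.flip β ∘ₗ P.lA.flip y ∘ₗ P.rB α = P.form (α * P.rA β y) := by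
    ext q
    simp [← P.form_mul_right, P.form_mul_right', P.form_mul_left']
  rw [sliceRight_rTensor, sliceRight_lTensor, sliceRight_J, h, sliceRight_G, ← lB_lB]
  rfl

/-- Slices of `f(b ⊗ a₍₂₎) ⊗ a₍₁₎ y`, for `t = b ⊗ y` and for sums of such, if the slices of `f` are
given by a map `g` of `B`. -/
theorem sliceLeft_onPair (f : B ⊗[K] A →ₗ[K] A ⊗[K] B) (g : B →ₗ[K] B) (α : A) (β : B)
    (hf : ∀ b p, P.form.flip β (sliceRight (P.form α) (f (b ⊗ₜ p))) = P.form p (g b))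
    (a : A) (t : B ⊗[K] A) :
    sliceLeft (P.form α) (sliceLeft (P.form.flip β) (onPair f
      ((HA.cop.T₁.toLinearMap ∘ₗ TensorProduct.mk K A A a).lTensor B t))) =
      TensorProduct.lift (LinearMap.mul K A ∘ₗ P.lA.flip a ∘ₗ g) t := by
  induction t with
  | zero => simp
  | add x y hx hy => simp only [map_add, hx, hy]
  | tmul b y =>
    simp only [LinearMap.lTensor_tmul, LinearMap.comp_apply, mk_apply, LinearEquiv.coe_coe,
      lift.tmul, LinearMap.flip_apply, LinearMap.mul_apply']
    rw [← sliceLeft_cop_T₁_A]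
    generalize HA.cop.T₁ (a ⊗ₜ y) = s
    induction s with
    | zero => simp
    | add x y hx hy => simp only [map_add, tmul_add, hx, hy]
    | tmul p q =>
      rw [onPair_tmul, sliceLeft_tmul, LinearMap.flip_apply, ← hf]
      generalize f (b ⊗ₜ p) = u
      induction u with
      | zero => simp
      | add x y hx hy => simp only [map_add, add_tmul, add_smul, hx, hy]
      | tmul x z => simp [smul_tmul', mul_comm]

/-- `a₍₂₎ ⊗ b₍₁₎ ⊗ b₍₂₎ ▶ (a₍₁₎ y) = a₍₂₎ ◀ b₍₂₎ ⊗ b₍₁₎ ⊗ a₍₁₎ (b₍₃₎ ▶ y)`. -/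
theorem lTensor_J_cop_T₁ (a y : A) (b : B) :
    (P.J.flip b).lTensor A (HA.cop.T₁ (a ⊗ₜ y)) = onPair P.G₁
      ((HA.cop.T₁.toLinearMap ∘ₗ TensorProduct.mk K A A a).lTensor B (P.J y b)) := by
  refine P.ext_sliceLeft_A fun β => P.ext_sliceLeft_B fun α => ?_
  rw [P.sliceLeft_onPair P.G₁ ((LinearMap.mulRight K β) ∘ₗ P.rB α) α β (fun b p => by
    rw [sliceRight_G₁]
    simp [P.form_mul_right']), sliceLeft_lTensor, sliceLeft_cop_T₁_A, LinearMap.flip_apply,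
    sliceLeft_J, ← mul_J, J_rB]
  generalize P.J y b = t
  induction t with
  | zero => simp
  | add x y hx hy => simp only [map_add, hx, hy]
  | tmul x y => simp [lA_lA]

/-- Two expressions for `b₍₁₎ ▶ a₍₂₎ ⊗ b₍₂₎ ⊗ a₍₁₎ (b₍₃₎ ▶ y)`: on the left as
`a'₍₂₎ ⊗ b'₍₁₎ ⊗ a'₍₁₎ (b'₍₂₎ ▶ y)` for `a' ⊗ b' = b₍₁₎ ▶ a ⊗ b₍₂₎`, on the right by applying `G` to
the first two legs of `b₍₁₎ ⊗ a₍₂₎ ⊗ a₍₁₎ (b₍₂₎ ▶ y)`. -/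
theorem lift_J_G (a y : A) (b : B) :
    TensorProduct.lift (LinearMap.mk₂ K (fun a' b' => TensorProduct.leftComm K B A A
      ((HA.cop.T₁.toLinearMap ∘ₗ TensorProduct.mk K A A a').lTensor B (P.J y b')))
      (fun a a' b => by simp [LinearMap.comp_add, LinearMap.lTensor_add])
      (fun c a b => by simp [LinearMap.comp_smul, LinearMap.lTensor_smul])
      (fun a b b' => by simp) (fun c a b => by simp)) (P.G (b ⊗ₜ a)) = onPair P.G
      ((HA.cop.T₁.toLinearMap ∘ₗ TensorProduct.mk K A A a).lTensor B (P.J y b)) := by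
  refine P.ext_sliceLeft_A fun β => P.ext_sliceLeft_B fun α => ?_
  rw [P.sliceLeft_onPair P.G ((LinearMap.mulLeft K β) ∘ₗ P.lB α) α β (fun b p => by
    rw [sliceRight_G]
    simp [P.form_mul_right])]
  have h1 : ∀ (a' : A) (t : B ⊗[K] A), sliceLeft (P.form α) (sliceLeft (P.form.flip β)
      (TensorProduct.leftComm K B A A
        ((HA.cop.T₁.toLinearMap ∘ₗ TensorProduct.mk K A A a').lTensor B t))) =
      P.lA β a' * sliceLeft (P.form α) t := by
    intro a' t
    induction t with
    | zero => simp
    | add x y hx hy => simp only [map_add, mul_add, hx, hy]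
    | tmul b y =>
      simp only [LinearMap.lTensor_tmul, LinearMap.comp_apply, mk_apply, LinearEquiv.coe_coe,
        sliceLeft_tmul, mul_smul_comm]
      rw [← sliceLeft_cop_T₁_A]
      generalize HA.cop.T₁ (a' ⊗ₜ y) = s
      induction s with
      | zero => simp
      | add x y hx hy => simp only [map_add, tmul_add, smul_add, hx, hy]
      | tmul p q => simp [smul_smul, mul_comm]
  have h2 := congrArg (LinearMap.mul' K A ∘ₗ (P.lA β).rTensor A) (P.lTensor_G_eq_rTensor_J α a y b)
  refine Eq.trans ?_ (h2.trans ?_)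
  · generalize P.G (b ⊗ₜ a) = t
    induction t with
    | zero => simp
    | add x y hx hy => simp only [map_add, hx, hy]
    | tmul x y => rw [lift.tmul, LinearMap.mk₂_apply, h1, sliceLeft_J]; simp
  · generalize P.J y b = t
    induction t with
    | zero => simp
    | add x y hx hy => simp only [map_add, hx, hy]
    | tmul x y => simp [lA_lA]

/-- The tensors `b₍₁₎ ⊗ a₍₂₎ ⊗ a₍₁₎ (b₍₂₎ ▶ y)` span `B ⊗ A ⊗ A`. -/
theorem ext_cop_T₁_J {U : Type*} [AddCommGroup U] [Module K U]
    {f g : B ⊗[K] (A ⊗[K] A) →ₗ[K] U}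
    (h : ∀ a y b, f ((HA.cop.T₁.toLinearMap ∘ₗ TensorProduct.mk K A A a).lTensor B (P.J y b)) =
      g ((HA.cop.T₁.toLinearMap ∘ₗ TensorProduct.mk K A A a).lTensor B (P.J y b))) : f = g := by
  refine TensorProduct.ext' fun b s => ?_
  obtain ⟨s, rfl⟩ := HA.cop.T₁.surjective s
  induction s with
  | zero => simp
  | add x y hx hy => simp only [map_add, tmul_add, hx, hy]
  | tmul a y =>
    obtain ⟨t, ht⟩ := P.J_surjective (b ⊗ₜ y)
    have key : ∀ t : A ⊗[K] B,
        f ((HA.cop.T₁.toLinearMap ∘ₗ TensorProduct.mk K A A a).lTensor B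
          (TensorProduct.lift P.J t)) =
        g ((HA.cop.T₁.toLinearMap ∘ₗ TensorProduct.mk K A A a).lTensor B
          (TensorProduct.lift P.J t)) := by
      intro t
      induction t with
      | zero => simp
      | add x y hx hy => simp only [map_add, hx, hy]
      | tmul x y => exact h a x y
    simpa [ht] using key t

/-- The relation `b₍₁₎ · ((a ◀ b₍₂₎) · h) = (b₍₁₎ ▶ a) · (b₍₂₎ · h)`, obtained by computing
`b ▶ (a h(y))` in two ways. -/
theorem actionB_actionA_G₁ (h : A ⊗[K] B) (t : B ⊗[K] A) :
    TensorProduct.lift (LinearMap.flip (LinearMap.compl₂ P.actionB (P.actionA.flip h)))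
      (P.G₁ t) = TensorProduct.lift (LinearMap.compl₂ P.actionA (P.actionB.flip h)) (P.G t) := by
  let X : A ⊗[K] B →ₗ[K] A ⊗[K] B :=
    TensorProduct.lift (LinearMap.flip (LinearMap.compl₂ P.actionB (P.actionA.flip h)))
  let Y : A ⊗[K] B →ₗ[K] A ⊗[K] B :=
    TensorProduct.lift (LinearMap.compl₂ P.actionA (P.actionB.flip h))
  -- `p ⊗ (b ⊗ q) ↦ π(Z(p ⊗ b)) q`
  let ev : (A ⊗[K] B →ₗ[K] A ⊗[K] B) → A ⊗[K] (B ⊗[K] A) →ₗ[K] A := fun Z =>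
    TensorProduct.lift (P.rep ∘ₗ Z) ∘ₗ (TensorProduct.assoc K A B A).symm.toLinearMap
  have hev : ∀ Z f b p q, ev Z (onPair f (b ⊗ₜ (p ⊗ₜ q))) = P.rep (Z (f (b ⊗ₜ p))) q := by
    intro Z f b p q
    simp [ev, onPair_tmul]
  have hX : ∀ a y b, ev X ((P.J.flip b).lTensor A (HA.cop.T₁ (a ⊗ₜ y))) =
      P.lA b (a * P.rep h y) := by
    intro a y b
    rw [← rep_actionA_T₁]
    generalize HA.cop.T₁ (a ⊗ₜ y) = s
    induction s with
    | zero => simp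
    | add x y hx hy => simp only [map_add, hx, hy]
    | tmul p q =>
      simp only [LinearMap.lTensor_tmul, LinearMap.flip_apply, lift.tmul, LinearMap.comp_apply]
      rw [← rep_actionB_J]
      generalize P.J q b = t
      induction t with
      | zero => simp
      | add x y hx hy => simp only [map_add, tmul_add, hx, hy]
      | tmul x y => simp [ev, X]
  have hY : ∀ a y b, ev Y (TensorProduct.leftComm K B A A
      ((HA.cop.T₁.toLinearMap ∘ₗ TensorProduct.mk K A A a).lTensor B (P.J y b))) =
      a * P.lA b (P.rep h y) := by
    intro a y b
    rw [← rep_actionB_J]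
    generalize P.J y b = t
    induction t with
    | zero => simp
    | add x y hx hy => simp only [map_add, mul_add, hx, hy]
    | tmul b y =>
      simp only [LinearMap.lTensor_tmul, LinearMap.flip_apply, lift.tmul, LinearMap.comp_apply,
        mk_apply, LinearEquiv.coe_coe]
      rw [← rep_actionA_T₁]
      generalize HA.cop.T₁ (a ⊗ₜ y) = s
      induction s with
      | zero => simp
      | add x y hx hy => simp only [map_add, tmul_add, hx, hy]
      | tmul x y => simp [ev, Y]
  have hXY : ev X ∘ₗ onPair P.G₁ = ev Y ∘ₗ onPair P.G := by
    refine P.ext_cop_T₁_J fun a y b => ?_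
    change ev X (onPair P.G₁ _) = ev Y (onPair P.G _)
    rw [← lTensor_J_cop_T₁, hX, ← lift_J_G, ← rep_G]
    generalize P.G (b ⊗ₜ a) = t
    induction t with
    | zero => simp
    | add x y hx hy => simp only [map_add, LinearMap.add_apply, hx, hy]
    | tmul x z => rw [lift.tmul, LinearMap.mk₂_apply, hY, rep_tmul]
  have : X ∘ₗ P.G₁ = Y ∘ₗ P.G := by
    refine TensorProduct.ext' fun b p => P.rep_injective (LinearMap.ext fun q => ?_)
    have := LinearMap.congr_fun hXY (b ⊗ₜ (p ⊗ₜ q))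
    change ev X (onPair P.G₁ _) = ev Y (onPair P.G _) at this
    rwa [hev, hev] at this
  exact LinearMap.congr_fun this t

end HopfPairing

/-! ### The twist map and the module structure -/

namespace HopfPairing

variable {K : Type*} [Field K]
  {A : Type*} [NonUnitalRing A] [Module K A] [IsScalarTower K A A] [SMulCommClass K A A]
  {B : Type*} [NonUnitalRing B] [Module K B] [IsScalarTower K B B] [SMulCommClass K B B]
  {HA : RegularMultiplierHopfAlgebra K A} {HB : RegularMultiplierHopfAlgebra K B}
  (P : HopfPairing HA HB)

/-- `a ◀ b₍₃₎ S⁻¹(b₍₂₎) ⊗ b₍₁₎ = a ⊗ b`. -/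
theorem G'_comm_G₁ (b : B) (a : A) :
    P.G' (TensorProduct.comm K A B (P.G₁ (b ⊗ₜ a))) = a ⊗ₜ b := by
  refine P.dualCopA.eq_of_r
    (f := P.G' ∘ₗ (TensorProduct.comm K A B).toLinearMap ∘ₗ P.G₁ ∘ₗ TensorProduct.mk K B A b)
    (g := (TensorProduct.mk K A B).flip b) (fun c a => ?_) a
  change P.G' (TensorProduct.comm K A B (P.G₁ (b ⊗ₜ P.rA c a))) = P.rA c a ⊗ₜ b
  refine P.ext_sliceRight_B fun α => ?_
  obtain ⟨ε, h, h1, h2⟩ := HB.cop_isAntipode_antipode_symm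
  have h3 : ∀ t : B ⊗[K] B, sliceRight (P.form α) (P.G' (TensorProduct.comm K A B
      ((P.rA.flip a).rTensor B t))) = P.rA (LinearMap.mul' K B
        (HB.antipode.symm.toLinearMap.lTensor B ((P.rB α).lTensor B t))) a := by
    intro t
    induction t with
    | zero => simp
    | add x y hx hy => simp only [map_add, hx, hy, LinearMap.add_apply]
    | tmul u v =>
      simp only [LinearMap.rTensor_tmul, comm_tmul, sliceRight_G']
      simp [rAInv, rA_rA]
  have h4 := P.dualCopB.T₂_r P.kSpans_dualCopB α c b
  change HB.cop.T₂ (c ⊗ₜ P.rB α b) = (P.rB α).lTensor B _ at h4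
  have h5 : ε (P.rB α b) = P.form α b := P.dualCopB.counit_r P.kSpans_dualCopB h α b
  rw [G₁_rA, h3, ← h4, h2, h5, sliceRight_tmul, map_smul, LinearMap.smul_apply]

/-- Expressions for `c b₍₃₎ ⊗ b₍₁₎ c' ⊗ b₍₂₎`, with `α` applied to the last leg, in terms of
`(c ⊗ 1)Δᶜᵒᵖ(b)` and of `Δᶜᵒᵖ(b)(1 ⊗ c')`. -/
theorem rTensor_cop_T₁_cop_T₂ (α : A) (b c c' : B) :
    (LinearMap.mulRight K c' ∘ₗ P.lB α).lTensor B (HB.cop.T₂ (c ⊗ₜ b)) =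
      (LinearMap.mulLeft K c ∘ₗ P.rB α).rTensor B (HB.cop.T₁ (b ⊗ₜ c')) := by
  refine P.ext_sliceRight_B fun α' => ?_
  have h1 : P.form α' ∘ₗ LinearMap.mulRight K c' ∘ₗ P.lB α = P.form (P.lA c' α' * α) := by
    ext x
    simp [P.form_mul_right, P.form_mul_left]
  have h2 : sliceRight (P.form α') (HB.cop.T₁ (b ⊗ₜ c')) = P.rB (P.lA c' α') b :=
    P.dualCopB.sliceRight_T₁ α' b c'
  rw [sliceRight_lTensor, sliceRight_rTensor, h1, h2, sliceRight_cop_T₂_B]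
  simp [rB_rB]

/-- Both sides are `b₍₁₎ ▶ a ◀ b₍₃₎ ⊗ b₍₂₎`. -/
theorem G_comm_G₁ (b : B) (a : A) :
    P.G (TensorProduct.comm K A B (P.G₁ (b ⊗ₜ a))) =
      P.G₁ (TensorProduct.comm K A B (P.G (b ⊗ₜ a))) := by
  refine P.dualCopA.eq_of_r
    (f := P.G ∘ₗ (TensorProduct.comm K A B).toLinearMap ∘ₗ P.G₁ ∘ₗ TensorProduct.mk K B A b)
    (g := P.G₁ ∘ₗ (TensorProduct.comm K A B).toLinearMap ∘ₗ P.G ∘ₗ TensorProduct.mk K B A b)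
    (fun c a => ?_) a
  -- both `c` and `c'` are needed to cover the outer legs of `b₍₁₎ ⊗ b₍₂₎ ⊗ b₍₃₎`
  refine P.dualA.eq_of_r
    (f := P.G ∘ₗ (TensorProduct.comm K A B).toLinearMap ∘ₗ P.G₁ ∘ₗ TensorProduct.mk K B A b ∘ₗ
      P.rA c)
    (g := P.G₁ ∘ₗ (TensorProduct.comm K A B).toLinearMap ∘ₗ P.G ∘ₗ TensorProduct.mk K B A b ∘ₗ
      P.rA c) (fun c' a => ?_) a
  change P.G (TensorProduct.comm K A B (P.G₁ (b ⊗ₜ P.rA c (P.lA c' a)))) =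
    P.G₁ (TensorProduct.comm K A B (P.G (b ⊗ₜ P.rA c (P.lA c' a))))
  refine P.ext_sliceRight_B fun α => ?_
  -- `u ⊗ u' ↦ u' ▶ a ◀ u`
  let Ψ : B ⊗[K] B →ₗ[K] A := TensorProduct.lift
    (LinearMap.flip (LinearMap.compl₂ P.lA (P.rA.flip a)))
  have h1 : ∀ t : B ⊗[K] B, sliceRight (P.form α) (P.G (TensorProduct.comm K A B
      ((P.rA.flip (P.lA c' a)).rTensor B t))) =
      Ψ ((LinearMap.mulRight K c' ∘ₗ P.lB α).lTensor B t) := by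
    intro t
    induction t with
    | zero => simp
    | add x y hx hy => simp only [map_add, hx, hy]
    | tmul u v =>
      simp only [LinearMap.rTensor_tmul, comm_tmul, sliceRight_G, LinearMap.flip_apply, rA_lA,
        lA_lA]
      simp [Ψ]
  have h2 : ∀ t : B ⊗[K] B, sliceRight (P.form α) (P.G₁ (TensorProduct.comm K A B
      ((P.lA.flip (P.rA c a)).rTensor B (TensorProduct.comm K B B t)))) =
      Ψ ((LinearMap.mulLeft K c ∘ₗ P.rB α).rTensor B t) := by
    intro t
    induction t with
    | zero => simp
    | add x y hx hy => simp only [map_add, hx, hy]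
    | tmul u v =>
      simp only [LinearMap.rTensor_tmul, comm_tmul, sliceRight_G₁, LinearMap.flip_apply, rA_lA,
        rA_rA]
      simp [Ψ]
  rw [G₁_rA, h1, rA_lA, G_lA, h2, rTensor_cop_T₁_cop_T₂]

theorem twist_comm_G₁ (t : B ⊗[K] A) :
    P.twist (TensorProduct.comm K A B (P.G₁ t)) = P.G t := by
  have h1 : ∀ t, P.G (TensorProduct.comm K A B (P.G₁ t)) =
      P.G₁ (TensorProduct.comm K A B (P.G t)) := by
    intro t
    induction t with
    | zero => simp
    | add x y hx hy => simp only [map_add, hx, hy]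
    | tmul b a => exact P.G_comm_G₁ b a
  have h2 : ∀ t : A ⊗[K] B, P.G' (TensorProduct.comm K A B (P.G₁ (TensorProduct.comm K A B t))) =
      t := by
    intro t
    induction t with
    | zero => simp
    | add x y hx hy => simp only [map_add, hx, hy]
    | tmul a b => exact P.G'_comm_G₁ b a
  simp only [twist, LinearMap.comp_apply, LinearEquiv.coe_coe]
  rw [h1, h2]

theorem lift_action (h : A ⊗[K] B) :
    TensorProduct.lift (LinearMap.compl₂ P.actionA (P.actionB.flip h)) = P.action.flip h :=
  TensorProduct.ext' fun a b => by simp [action_tmul]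

/-- The commutation relation of `𝒟`: the actions of `b` and `a` compose to that of
`T(b ⊗ a) = b₍₁₎ ▶ a ◀ S⁻¹(b₍₃₎) ⊗ b₍₂₎`. -/
theorem actionB_actionA (b : B) (a : A) (h : A ⊗[K] B) :
    P.actionB b (P.actionA a h) = P.action (P.twist (b ⊗ₜ a)) h := by
  obtain ⟨t, ht⟩ := P.G₁_surjective (a ⊗ₜ b)
  have := P.actionB_actionA_G₁ h t
  rw [lift_action, ← twist_comm_G₁, ht] at this
  simpa using this

theorem action_doubleMul (x y h : A ⊗[K] B) :
    P.action (P.doubleMul x y) h = P.action x (P.action y h) := by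
  induction x with
  | zero => simp
  | add x x' hx hx' => simp only [map_add, LinearMap.add_apply, hx, hx']
  | tmul a b =>
    induction y with
    | zero => simp
    | add y y' hy hy' => simp only [map_add, LinearMap.add_apply, hy, hy']
    | tmul a' b' =>
      rw [action_tmul, action_tmul, actionB_actionA]
      simp only [doubleMul, curry_apply, LinearMap.comp_apply, LinearEquiv.coe_coe,
        tensorTensorTensorAssoc_tmul, LinearMap.rTensor_tmul, LinearMap.lTensor_tmul]
      generalize P.twist (b ⊗ₜ a') = t
      induction t with
      | zero => simp
      | add x y hx hy =>
        simp only [map_add, tmul_add, add_tmul, LinearMap.add_apply, hx, hy]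
      | tmul u v => simp [action_tmul, actionA_mul, actionB_mul]

theorem span_action :
    Submodule.span K {z : A ⊗[K] B | ∃ x h : A ⊗[K] B, P.action x h = z} = ⊤ := by
  rw [eq_top_iff]
  rintro z -
  obtain ⟨t, rfl⟩ := P.actionA_surjective z
  induction t with
  | zero => simp
  | add x y hx hy => rw [map_add]; exact Submodule.add_mem _ hx hy
  | tmul a h =>
    obtain ⟨s, rfl⟩ := P.actionB_surjective h
    induction s with
    | zero => simp
    | add x y hx hy => rw [map_add, tmul_add, map_add]; exact Submodule.add_mem _ hx hy
    | tmul b h => exact Submodule.subset_span ⟨a ⊗ₜ b, h, by rw [action_tmul]; rfl⟩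

end HopfPairing

theorem proposition3p3 {K : Type*} [Field K]
    {A : Type*} [NonUnitalRing A] [Module K A] [IsScalarTower K A A] [SMulCommClass K A A]
    {B : Type*} [NonUnitalRing B] [Module K B] [IsScalarTower K B B] [SMulCommClass K B B]
    (HA : RegularMultiplierHopfAlgebra K A) (HB : RegularMultiplierHopfAlgebra K B)
    (P : HopfPairing HA HB) :
    P.WellDefined ∧
    (∀ x y h : A ⊗[K] B, P.action (P.doubleMul x y) h = P.action x (P.action y h)) ∧
    Submodule.span K {z : A ⊗[K] B | ∃ x h : A ⊗[K] B, P.action x h = z} = ⊤ := by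
  exact ⟨P.wellDefined, P.action_doubleMul, P.span_action⟩
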